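/- For a coupling constant $\lambda>0$ let $V(n)=\lambda\,\chi_{[1-\phi^{-1},1)}(n\phi^{-1} \bmod 1)$, $\phi=\frac{1+\sqrt5}{2}$, be the Fibonacci potential with phase $\theta=0$. For $z\in\mathbb C$ and $n\ge 1$ let $\Phi(n,z)=T(n,z)\cdots T(1,z)$ with $T(j,z)=\begin{pmatrix} z-V(j) & -1\\ 1 & 0\end{pmatrix}$. Let $F_0=F_1=1$, $F_{k+1}=F_k+F_{k-1}$, put $x_0(z)=z/2$ and $x_k(z)=\frac12\operatorname{Tr}\Phi(F_k,z)$ for $k\ge1$, and for $\delta\ge 0$ let $$\sigma_k^\delta=\{z\in\mathbb C: |x_k(z)|\le 1+\delta\}.$$ For a root $z$ of $x_k$ let $m_k(z)=\#\{0\le l\le k-1: |x_l(z)|\le 1\}$. Let $\lambda_0(\delta)=\left[12(1+\delta)^2+8(1+\delta)^3+4\right]^{1/2}$, $S_u(\lambda)=2\lambda+22$, $S_l(\lambda)=\frac12\left((\lambda-4)+\sqrt{(\lambda-4)^2-12}\right)$, and $B(z,r)=\{w\in\mathbb C:|w-z|<r\}$. Proposition (distortion). For every $\delta>0$ there are constants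 $c_\delta,d_\delta>0$, depending only on $\delta$, such that for every $k\ge 3$: (i) if $\lambda>\lambda_0(2\delta)$, then $$\bigcup_{z:\,x_k(z)=0} B\left(z,\,c_\delta\,S_u(\lambda)^{-m_k(z)}\right)\subseteq\sigma_k^\delta;$$ (ii) if $\lambda>\max\{\lambda_0(2\delta),8\}$, then $$\sigma_k^\delta\subseteq\bigcup_{z:\,x_k(z)=0} B\left(z,\,d_\delta\,S_l(\lambda)^{-m_k(z)}\right).$$ In particular, both inclusions hold if $\lambda>\max\{\lambda_0(2\delta),8\}$. -/

import Mathlib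

namespace FibonacciHamiltonian

noncomputable section

/-- The Fibonacci potential
`V(n) = lam * χ_{[1 - φ⁻¹, 1)} (n φ⁻¹ + θ mod 1)`, with `φ` the golden mean. -/
def potential (lam θ : ℝ) (n : ℤ) : ℝ :=
  lam * (Set.Ico (1 - Real.goldenRatio⁻¹) 1).indicator (fun _ => (1 : ℝ))
    (Int.fract ((n : ℝ) * Real.goldenRatio⁻¹ + θ))

/-- The one-step transfer matrix `T(n, z)` of the difference equation
`u(n+1) + u(n-1) + V(n) u(n) = z u(n)`. -/
def stepMatrix (lam θ : ℝ) (n : ℤ) (z : ℂ) : Matrix (Fin 2) (Fin 2) ℂ :=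
  !![z - (potential lam θ n : ℂ), -1; 1, 0]

/-- The transfer matrix `Φ_θ(n, z) = T(n, z) ⋯ T(1, z)` for `n ≥ 0`. -/
def transferMatrix (lam θ : ℝ) : ℕ → ℂ → Matrix (Fin 2) (Fin 2) ℂ
  | 0, _ => 1
  | n + 1, z => stepMatrix lam θ ((n : ℤ) + 1) z * transferMatrix lam θ n z

/-- The Fibonacci numbers with the convention `F_0 = F_1 = 1`. -/
def fibNum (k : ℕ) : ℕ := Nat.fib (k + 1)

/-- The matrices `M_k(z) = Φ_{θ = 0}(F_k, z)`, used for `k ≥ 1`. -/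
def fibMatrix (lam : ℝ) (k : ℕ) (z : ℂ) : Matrix (Fin 2) (Fin 2) ℂ :=
  transferMatrix lam 0 (fibNum k) z

/-- The half traces: `x_0(z) = z / 2` and `x_k(z) = (1/2) Tr M_k(z)` for `k ≥ 1`. -/
def halfTrace (lam : ℝ) : ℕ → ℂ → ℂ
  | 0, z => z / 2
  | k + 1, z => (fibMatrix lam (k + 1) z).trace / 2

/-- The set `σ_k^δ = {z ∈ ℂ : |x_k(z)| ≤ 1 + δ}`. -/
def sigmaSet (lam : ℝ) (k : ℕ) (δ : ℝ) : Set ℂ :=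
  {z | ‖halfTrace lam k z‖ ≤ 1 + δ}

/-- `m(z) = #{0 ≤ l ≤ k - 1 : |x_l(z)| ≤ 1}`. -/
def returnCount (lam : ℝ) (k : ℕ) (z : ℂ) : ℕ :=
  ((Finset.range k).filter (fun l => ‖halfTrace lam l z‖ ≤ 1)).card

/-- `λ₀(δ) = [12 (1 + δ)² + 8 (1 + δ)³ + 4]^{1/2}`. -/
def couplingThreshold (δ : ℝ) : ℝ :=
  Real.sqrt (12 * (1 + δ) ^ 2 + 8 * (1 + δ) ^ 3 + 4)

/-- `S_u(λ) = 2 λ + 22`. -/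
def Su (lam : ℝ) : ℝ := 2 * lam + 22

/-- `S_l(λ) = ((λ - 4) + √((λ - 4)² - 12)) / 2`. -/
def Sl (lam : ℝ) : ℝ := (1 / 2) * ((lam - 4) + Real.sqrt ((lam - 4) ^ 2 - 12))

/-- The zeros of `x_k`. -/
def zeroSet (lam : ℝ) (k : ℕ) : Set ℂ := {z | halfTrace lam k z = 0}

end

end FibonacciHamiltonian

/-! The half traces obey x_{k+1} = 2 x_k x_{k-1} - x_{k-2} and conserve the Fricke–Vogt invariant K
= 1 + λ²/4. Put D = 1 + 2δ. The condition λ > λ₀(2δ) says K > 2 + 3D² + 2D³, so three consecutive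
half traces are never all bounded by D, while a bounded one followed by two larger than D escapes
for good. The bounded values leading up to a bounded x_k therefore form a chain with gaps one or
two, starting from x_{-1} = 1.

Differentiating the invariant eliminates the derivative of a large value and compares the
derivatives at consecutive links. The ratio is at least 1 at level D; at level 1 it is at least λ -
4 if λ > 8, and at most S_u(λ) on the real line. The exponent m_k counts links, so at a zero |x_k'|
lies between (λ - 4)^m / 2 and S_u^m / 2 (`traceDer_lower`, `traceDer_upper`), and S_l ≤ λ - 4.

Growth at level D also shows that x_k has no critical point over the disc of radius D, hence inverse
branches there. The zeros of x_k are real, so by conjugation symmetry a branch at a zero is, up to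
sign, typically real: it preserves the sign of the imaginary part. Such functions satisfy explicit
distortion bounds (`typicallyReal_upper`, `typicallyReal_lower`), which here do the work of Koebe's
theorem and compare σ_k^δ with discs of radius comparable to 1 / |x_k'(z)|, with constants depending
only on δ. -/

namespace FibonacciHamiltonian

/-- Algebraic data of two consecutive steps along the chain of bounded half traces in which one
large value `c` has been passed; `x'` denotes the derivative of `x`. -/
structure TripleData (D K : ℝ) (a b c a' b' c' : ℂ) : Prop where
  norm_a : ‖a‖ ≤ D
  norm_b : ‖b‖ ≤ D
  norm_c : D < ‖c‖
  deriv_le : ‖b'‖ ≤ ‖a'‖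
  inv : a ^ 2 + b ^ 2 + c ^ 2 - 2 * a * b * c = K
  deriv_inv : a * a' + b * b' + c * c' - (a' * b * c + a * b' * c + a * b * c') = 0

/-! ### Derivative ratios across one large value. -/

section Simple

variable {D K : ℝ} {a b c a' b' c' e e' : ℂ}

/-- The factor `c - a * b` is half the partial derivative of the invariant in `c`; multiplying by it
lets the differentiated invariant replace `c'`, on which there is no bound. -/
lemma TripleData.simple_deriv (h : TripleData D K a b c a' b' c') (he : e = 2 * c * a - b)
    (he' : e' = 2 * (c' * a + c * a') - b') :
    e' * (c - a * b) = 2 * a' * (c ^ 2 - a ^ 2) - b' * (c - a * e) := by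
  subst he he'
  linear_combination 2 * a * h.deriv_inv

lemma TripleData.simple_mul_le (h : TripleData D K a b c a' b' c') (he : e = 2 * c * a - b)
    (hD : ‖e‖ ≤ D) : ‖a‖ * ‖c‖ ≤ D := by
  have h1 : 2 * (a * c) = e + b := by rw [he]; ring
  have h2 : 2 * (‖a‖ * ‖c‖) = ‖e + b‖ := by rw [← h1]; simp
  linarith [norm_add_le e b, h.norm_b]

/-- Vieta: `b` and `e` are the two roots of the invariant as a quadratic, so b + e = 2ac and be = a²
+ c² - K. -/
lemma TripleData.simple_sq_ge (h : TripleData D K a b c a' b' c') (he : e = 2 * c * a - b)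
    (hD : ‖e‖ ≤ D) : K - D ^ 2 - ‖a‖ ^ 2 ≤ ‖c‖ ^ 2 := by
  have h1 : (K : ℂ) = c ^ 2 + a ^ 2 - b * e := by rw [← h.inv, he]; ring
  have h2 : ‖(K : ℂ)‖ ≤ ‖c‖ ^ 2 + ‖a‖ ^ 2 + ‖b‖ * ‖e‖ := by
    rw [h1, ← norm_pow, ← norm_pow, ← norm_mul]
    exact (norm_sub_le _ _).trans (by gcongr; exact norm_add_le _ _)
  have h3 : K ≤ ‖(K : ℂ)‖ := by simpa using le_abs_self K
  have h4 : ‖b‖ * ‖e‖ ≤ D * D :=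
    mul_le_mul h.norm_b hD (norm_nonneg _) ((norm_nonneg _).trans h.norm_b)
  nlinarith

lemma TripleData.simple_sq_le (h : TripleData D K a b c a' b' c') (he : e = 2 * c * a - b)
    (hD : ‖e‖ ≤ D) : ‖c‖ ^ 2 ≤ |K| + D ^ 2 + ‖a‖ ^ 2 := by
  have h1 : c ^ 2 = K + b * e - a ^ 2 := by rw [← h.inv, he]; ring
  have h2 : ‖c‖ ^ 2 ≤ |K| + ‖b‖ * ‖e‖ + ‖a‖ ^ 2 := by
    rw [← norm_pow, h1, ← norm_pow, ← norm_mul]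
    refine (norm_sub_le _ _).trans (by gcongr; exact (norm_add_le _ _).trans (by simp))
  have h4 : ‖b‖ * ‖e‖ ≤ D * D :=
    mul_le_mul h.norm_b hD (norm_nonneg _) ((norm_nonneg _).trans h.norm_b)
  nlinarith

lemma TripleData.simple_lower (h : TripleData D K a b c a' b' c') (he : e = 2 * c * a - b)
    (he' : e' = 2 * (c' * a + c * a') - b') (hD : ‖e‖ ≤ D) :
    ‖a'‖ * (2 * (‖c‖ ^ 2 - ‖a‖ ^ 2) - (‖c‖ + D * ‖a‖)) ≤ ‖e'‖ * (‖c‖ + D * ‖a‖) := by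
  have key := h.simple_deriv he he'
  have h1 : ‖c - a * b‖ ≤ ‖c‖ + D * ‖a‖ := by
    refine (norm_sub_le _ _).trans ?_
    rw [norm_mul, mul_comm ‖a‖]
    gcongr; exact h.norm_b
  have h2 : ‖c - a * e‖ ≤ ‖c‖ + D * ‖a‖ := by
    refine (norm_sub_le _ _).trans ?_
    rw [norm_mul, mul_comm ‖a‖]
    gcongr
  have h3 : ‖c‖ ^ 2 - ‖a‖ ^ 2 ≤ ‖c ^ 2 - a ^ 2‖ := by
    rw [← norm_pow, ← norm_pow]; exact norm_sub_norm_le _ _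
  have h4 : 2 * ‖a'‖ * ‖c ^ 2 - a ^ 2‖ - ‖b'‖ * ‖c - a * e‖ ≤ ‖e'‖ * ‖c - a * b‖ := by
    have := norm_sub_norm_le (2 * a' * (c ^ 2 - a ^ 2)) (b' * (c - a * e))
    rw [← key] at this
    simpa using this
  have h5 : ‖b'‖ * ‖c - a * e‖ ≤ ‖a'‖ * (‖c‖ + D * ‖a‖) := by
    gcongr; exact h.deriv_le
  have h6 : ‖e'‖ * ‖c - a * b‖ ≤ ‖e'‖ * (‖c‖ + D * ‖a‖) := by gcongr
  have h7 : ‖a'‖ * (‖c‖ ^ 2 - ‖a‖ ^ 2) ≤ ‖a'‖ * ‖c ^ 2 - a ^ 2‖ := by gcongr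
  linarith

lemma TripleData.simple_upper (h : TripleData D K a b c a' b' c') (he : e = 2 * c * a - b)
    (he' : e' = 2 * (c' * a + c * a') - b') (hD : ‖e‖ ≤ D) :
    ‖e'‖ * (‖c‖ - D * ‖a‖) ≤ ‖a'‖ * (2 * (‖c‖ ^ 2 + ‖a‖ ^ 2) + (‖c‖ + D * ‖a‖)) := by
  have key := h.simple_deriv he he'
  have h1 : ‖c‖ - D * ‖a‖ ≤ ‖c - a * b‖ := by
    refine le_trans ?_ (norm_sub_norm_le _ _)
    rw [norm_mul, mul_comm ‖a‖]
    gcongr; exact h.norm_b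
  have h2 : ‖c - a * e‖ ≤ ‖c‖ + D * ‖a‖ := by
    refine (norm_sub_le _ _).trans ?_
    rw [norm_mul, mul_comm ‖a‖]
    gcongr
  have h3 : ‖c ^ 2 - a ^ 2‖ ≤ ‖c‖ ^ 2 + ‖a‖ ^ 2 := by
    rw [← norm_pow, ← norm_pow]; exact norm_sub_le _ _
  have h4 : ‖e'‖ * ‖c - a * b‖ ≤ 2 * ‖a'‖ * ‖c ^ 2 - a ^ 2‖ + ‖b'‖ * ‖c - a * e‖ := by
    have := norm_sub_le (2 * a' * (c ^ 2 - a ^ 2)) (b' * (c - a * e))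
    rw [← key] at this
    simpa using this
  have h5 : ‖b'‖ * ‖c - a * e‖ ≤ ‖a'‖ * (‖c‖ + D * ‖a‖) := by
    gcongr; exact h.deriv_le
  have h6 : ‖e'‖ * (‖c‖ - D * ‖a‖) ≤ ‖e'‖ * ‖c - a * b‖ := by gcongr
  have h7 : ‖a'‖ * ‖c ^ 2 - a ^ 2‖ ≤ ‖a'‖ * (‖c‖ ^ 2 + ‖a‖ ^ 2) := by gcongr
  linarith

lemma TripleData.simple_growth (h : TripleData D K a b c a' b' c') (he : e = 2 * c * a - b)
    (he' : e' = 2 * (c' * a + c * a') - b') (hD : ‖e‖ ≤ D) (hD1 : 1 ≤ D)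
    (hK : 2 + 3 * D ^ 2 + 2 * D ^ 3 ≤ K) : ‖a'‖ ≤ ‖e'‖ := by
  have h1 := h.simple_mul_le he hD
  have h2 := h.simple_sq_ge he hD
  have h3 := h.simple_lower he he' hD
  have hc := h.norm_c
  have ha0 := norm_nonneg a
  have hA := norm_nonneg a'
  generalize ‖a‖ = α at *
  generalize ‖c‖ = u at *
  have ha1 : α ≤ 1 := by nlinarith
  -- The hint is 2D³ + 1 ≥ 3D², whence u² ≥ 1 + 2D² + 2D³ ≥ 5D², and 2.2² = 4.84.
  have hu : (2.2 * D) ^ 2 ≤ u ^ 2 := by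
    nlinarith [mul_nonneg (sq_nonneg (D - 1)) (by linarith : 0 ≤ 2 * D + 1)]
  have hu' : 2.2 * D ≤ u := by nlinarith
  have h4 : D * α ≤ D := by nlinarith
  have hp : 0 < u + D * α := by nlinarith [mul_nonneg (by linarith : 0 ≤ D) ha0]
  have h5 : u + D * α ≤ 2 * (u ^ 2 - α ^ 2) - (u + D * α) := by nlinarith
  exact le_of_mul_le_mul_right ((mul_le_mul_of_nonneg_left h5 hA).trans h3) hp

lemma TripleData.simple_lower_ratio {lam : ℝ} (h : TripleData 1 (1 + lam ^ 2 / 4) a b c a' b' c')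
    (he : e = 2 * c * a - b) (he' : e' = 2 * (c' * a + c * a') - b') (hD : ‖e‖ ≤ 1)
    (hl : 8 < lam) : (lam - 4) * ‖a'‖ ≤ ‖e'‖ := by
  have h1 := h.simple_mul_le he hD
  have h2 := h.simple_sq_ge he hD
  have h3 := h.simple_lower he he' hD
  have hc := h.norm_c
  have ha0 := norm_nonneg a
  have hA := norm_nonneg a'
  generalize ‖a‖ = α at *
  generalize ‖c‖ = u at *
  have ha1 : α ≤ 1 := by nlinarith
  have hu : lam / 2 - 1 / 2 ≤ u := by nlinarith
  have hp : 0 < u + 1 * α := by linarith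
  have h5 : (lam - 4) * (u + 1 * α) ≤ 2 * (u ^ 2 - α ^ 2) - (u + 1 * α) := by
    have : α ≤ 1 / 2 := by nlinarith
    have h7 : lam - 4 ≤ 2 * u - 2 * α - 1 := by linarith
    nlinarith
  refine le_of_mul_le_mul_right ?_ hp
  calc (lam - 4) * ‖a'‖ * (u + 1 * α) = ‖a'‖ * ((lam - 4) * (u + 1 * α)) := by ring
    _ ≤ _ := (mul_le_mul_of_nonneg_left h5 hA).trans h3

lemma TripleData.simple_upper_ratio {lam : ℝ} (h : TripleData 1 (1 + lam ^ 2 / 4) a b c a' b' c')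
    (he : e = 2 * c * a - b) (he' : e' = 2 * (c' * a + c * a') - b') (hD : ‖e‖ ≤ 1)
    (hl0 : 4 < lam) (hl : 24 < lam ^ 2) : ‖e'‖ ≤ Su lam * ‖a'‖ := by
  have h1 := h.simple_mul_le he hD
  have h2 := h.simple_sq_ge he hD
  have h2' := h.simple_sq_le he hD
  have h3 := h.simple_upper he he' hD
  rw [abs_of_nonneg (by positivity)] at h2'
  have hc := h.norm_c
  have ha0 := norm_nonneg a
  have hA := norm_nonneg a'
  unfold Su
  generalize ‖a‖ = α at *
  generalize ‖c‖ = u at *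
  have ha1 : α ≤ 1 := by nlinarith
  have hu : 2 ≤ u := by nlinarith
  have ha2 : α ≤ 1 / 2 := by nlinarith
  have hu' : u ≤ lam / 2 + 1 := by nlinarith
  have hp : 0 < u - 1 * α := by linarith
  have h5 : 2 * (u ^ 2 + α ^ 2) + (u + 1 * α) ≤ (2 * lam + 22) * (u - 1 * α) := by
    have h6 : (4 * u + 18) * (u - 1 * α) ≤ (2 * lam + 22) * (u - 1 * α) := by
      apply mul_le_mul_of_nonneg_right _ hp.le; linarith
    nlinarith
  refine le_of_mul_le_mul_right ?_ hp
  calc _ ≤ _ := h3.trans (mul_le_mul_of_nonneg_left h5 hA)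
    _ = _ := by ring

end Simple

/-! ### Derivative ratios across two large values. -/

section Double

variable {D K : ℝ} {a b c d a' b' c' d' e e' : ℂ}

/-- Since e = (4a² - 1)c - 2ab, the differentiated invariant enters with weight 4a² - 1. -/
lemma TripleData.double_deriv (h : TripleData D K a b c a' b' c') (hd : d = 2 * a * c - b)
    (hd' : d' = 2 * (a' * c + a * c') - b') (he : e = 2 * d * a - c)
    (he' : e' = 2 * (d' * a + d * a') - c') :
    e' * (c - a * b) = a' * (4 * c * d - b * e - 4 * a ^ 3 + a) - b' * (d - a * e) := by
  subst hd hd' he he'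
  linear_combination (4 * a ^ 2 - 1) * h.deriv_inv

/-- The norm inequalities satisfied in a step that passes two large values `c` and `d`. -/
lemma TripleData.double_bounds (h : TripleData D K a b c a' b' c') (hd : d = 2 * a * c - b)
    (he : e = 2 * d * a - c) (hD : ‖e‖ ≤ D) :
    (4 * ‖a‖ ^ 2 - 1 ≤ ‖4 * a ^ 2 - 1‖ ∧ ‖4 * a ^ 2 - 1‖ * ‖c‖ ≤ D * (1 + 2 * ‖a‖) ∧
      ‖4 * a ^ 2 - 1‖ * ‖d‖ ≤ D * (1 + 2 * ‖a‖)) ∧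
    (K - ‖a‖ ^ 2 - D * ‖d‖ ≤ ‖c‖ ^ 2 ∧ K - ‖a‖ ^ 2 - D * ‖c‖ ≤ ‖d‖ ^ 2) ∧
    (‖d‖ ≤ 2 * ‖a‖ * ‖c‖ + D ∧ ‖c‖ ≤ 2 * ‖a‖ * ‖d‖ + D) := by
  have hb := h.norm_b
  have hK : K ≤ ‖(K : ℂ)‖ := by simpa using le_abs_self K
  refine ⟨⟨?_, ?_, ?_⟩, ⟨?_, ?_⟩, ?_, ?_⟩
  · have := norm_sub_norm_le (4 * a ^ 2) 1
    simpa using this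
  · have h1 : (4 * a ^ 2 - 1) * c = e + 2 * a * b := by rw [he, hd]; ring
    rw [← norm_mul, h1]
    refine (norm_add_le _ _).trans ?_
    simp only [norm_mul, Complex.norm_ofNat]
    nlinarith [mul_le_mul_of_nonneg_left hb (norm_nonneg a)]
  · have h1 : (4 * a ^ 2 - 1) * d = b + 2 * a * e := by rw [he, hd]; ring
    rw [← norm_mul, h1]
    refine (norm_add_le _ _).trans ?_
    simp only [norm_mul, Complex.norm_ofNat]
    nlinarith [mul_le_mul_of_nonneg_left hD (norm_nonneg a)]
  · have h1 : (K : ℂ) = c ^ 2 + a ^ 2 - b * d := by rw [← h.inv, hd]; ring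
    have h2 : ‖(K : ℂ)‖ ≤ ‖c‖ ^ 2 + ‖a‖ ^ 2 + ‖b‖ * ‖d‖ := by
      rw [h1, ← norm_pow, ← norm_pow, ← norm_mul]
      exact (norm_sub_le _ _).trans (by gcongr; exact norm_add_le _ _)
    nlinarith [mul_le_mul_of_nonneg_right hb (norm_nonneg d)]
  · have h1 : (K : ℂ) = d ^ 2 + a ^ 2 - c * e := by rw [← h.inv, he, hd]; ring
    have h2 : ‖(K : ℂ)‖ ≤ ‖d‖ ^ 2 + ‖a‖ ^ 2 + ‖c‖ * ‖e‖ := by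
      rw [h1, ← norm_pow, ← norm_pow, ← norm_mul]
      exact (norm_sub_le _ _).trans (by gcongr; exact norm_add_le _ _)
    nlinarith [mul_le_mul_of_nonneg_left hD (norm_nonneg c)]
  · rw [hd]
    refine (norm_sub_le _ _).trans ?_
    simp only [norm_mul, Complex.norm_ofNat]
    linarith
  · have h1 : c = 2 * a * d - e := by rw [he]; ring
    have h2 : ‖c‖ ≤ ‖2 * a * d‖ + ‖e‖ := by rw [h1]; exact norm_sub_le _ _
    simp only [norm_mul, Complex.norm_ofNat] at h2
    linarith

lemma TripleData.double_lower (h : TripleData D K a b c a' b' c') (hd : d = 2 * a * c - b)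
    (hd' : d' = 2 * (a' * c + a * c') - b') (he : e = 2 * d * a - c)
    (he' : e' = 2 * (d' * a + d * a') - c') (hD : ‖e‖ ≤ D) :
    ‖a'‖ * (4 * ‖c‖ * ‖d‖ - D ^ 2 - ‖a‖ * ‖4 * a ^ 2 - 1‖ - (‖d‖ + D * ‖a‖))
      ≤ ‖e'‖ * (‖c‖ + D * ‖a‖) := by
  have key := h.double_deriv hd hd' he he'
  have hb := h.norm_b
  have h1 : ‖c - a * b‖ ≤ ‖c‖ + D * ‖a‖ := by
    refine (norm_sub_le _ _).trans ?_
    rw [norm_mul, mul_comm ‖a‖]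
    gcongr
  have h2 : ‖d - a * e‖ ≤ ‖d‖ + D * ‖a‖ := by
    refine (norm_sub_le _ _).trans ?_
    rw [norm_mul, mul_comm ‖a‖]
    gcongr
  have h3 : 4 * ‖c‖ * ‖d‖ - D ^ 2 - ‖a‖ * ‖4 * a ^ 2 - 1‖ ≤
      ‖4 * c * d - b * e - 4 * a ^ 3 + a‖ := by
    have e1 : 4 * c * d - b * e - 4 * a ^ 3 + a = 4 * c * d - (b * e + a * (4 * a ^ 2 - 1)) := by
      ring
    rw [e1]
    have e2 := norm_sub_norm_le (4 * c * d) (b * e + a * (4 * a ^ 2 - 1))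
    have e3 := norm_add_le (b * e) (a * (4 * a ^ 2 - 1))
    have e4 : ‖b * e‖ ≤ D * D := by
      rw [norm_mul]
      exact mul_le_mul hb hD (norm_nonneg _) ((norm_nonneg _).trans hb)
    rw [norm_mul a] at e3
    simp only [norm_mul (_ * c), norm_mul (4 : ℂ), Complex.norm_ofNat] at e2
    nlinarith
  have h4 : ‖a'‖ * ‖4 * c * d - b * e - 4 * a ^ 3 + a‖ - ‖b'‖ * ‖d - a * e‖
      ≤ ‖e'‖ * ‖c - a * b‖ := by
    simp only [← norm_mul]
    rw [key]
    exact norm_sub_norm_le _ _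
  have h5 : ‖b'‖ * ‖d - a * e‖ ≤ ‖a'‖ * (‖d‖ + D * ‖a‖) := by
    gcongr; exact h.deriv_le
  have h6 : ‖e'‖ * ‖c - a * b‖ ≤ ‖e'‖ * (‖c‖ + D * ‖a‖) := by gcongr
  have h7 := mul_le_mul_of_nonneg_left h3 (norm_nonneg a')
  linarith

/-- From (4a² - 1)c = e + 2ab and (4a² - 1)d = b + 2ae, large `c` and `d` keep `a` from being large;
the common factor 1 + 2|a| cancels. -/
lemma TripleData.double_norm_le_one (h : TripleData D K a b c a' b' c') (hd : d = 2 * a * c - b)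
    (he : e = 2 * d * a - c) (hDd : D < ‖d‖) (hD : ‖e‖ ≤ D) :
    2 * ‖a‖ * ‖c‖ ≤ ‖c‖ + D ∧ 2 * ‖a‖ * ‖d‖ ≤ ‖d‖ + D ∧ ‖a‖ ≤ 1 := by
  obtain ⟨⟨h1, h2, h3⟩, -, -⟩ := h.double_bounds hd he hD
  have hc := h.norm_c
  have hD0 := (norm_nonneg _).trans hD
  have ha := norm_nonneg a
  generalize ‖a‖ = α at *
  generalize ‖4 * a ^ 2 - 1‖ = w at *
  generalize ‖c‖ = u at *
  generalize ‖d‖ = v at *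
  have e1 : 2 * α * u ≤ u + D := by
    have : (2 * α - 1) * u * (1 + 2 * α) ≤ D * (1 + 2 * α) := by nlinarith
    have := le_of_mul_le_mul_right this (by linarith)
    linarith
  have e2 : 2 * α * v ≤ v + D := by
    have : (2 * α - 1) * v * (1 + 2 * α) ≤ D * (1 + 2 * α) := by nlinarith
    have := le_of_mul_le_mul_right this (by linarith)
    linarith
  exact ⟨e1, e2, by nlinarith⟩

lemma TripleData.double_growth (h : TripleData D K a b c a' b' c') (hd : d = 2 * a * c - b)
    (hd' : d' = 2 * (a' * c + a * c') - b') (he : e = 2 * d * a - c)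
    (he' : e' = 2 * (d' * a + d * a') - c') (hDd : D < ‖d‖) (hD : ‖e‖ ≤ D) (hD1 : 1 ≤ D)
    (hK : 2 + 3 * D ^ 2 + 2 * D ^ 3 ≤ K) : ‖a'‖ ≤ ‖e'‖ := by
  obtain ⟨e1, e2, ha1⟩ := h.double_norm_le_one hd he hDd hD
  obtain ⟨⟨h1, h2, h3⟩, ⟨h4, h5⟩, h6, h7⟩ := h.double_bounds hd he hD
  have h8 := h.double_lower hd hd' he he' hD
  have hc := h.norm_c
  have ha := norm_nonneg a
  have hA := norm_nonneg a'
  generalize ‖a‖ = α at *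
  generalize ‖4 * a ^ 2 - 1‖ = w at *
  generalize ‖c‖ = u at *
  generalize ‖d‖ = v at *
  have hcube : 0 ≤ 1 + 2 * D ^ 3 - 3 * D ^ 2 := by
    nlinarith [mul_nonneg (sq_nonneg (D - 1)) (by linarith : 0 ≤ 2 * D + 1)]
  have ha2 : α ^ 2 ≤ 1 := by nlinarith
  -- Here v ≤ u + 2D, so u² + Du ≥ K - 1 - 2D² ≥ 4D², while 1.5² + 1.5 < 4.
  have hu : 1.5 * D ≤ u := by nlinarith
  have hv : 1.5 * D ≤ v := by nlinarith
  have hw : w ≤ 2 := by nlinarith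
  have hp : 0 < u + D * α := by nlinarith [mul_nonneg (by linarith : 0 ≤ D) ha]
  have h9 : u + D * α ≤ 4 * u * v - D ^ 2 - α * w - (v + D * α) := by
    have e3 : α * w ≤ 2 := by nlinarith
    have e4 : D * α ≤ D := by nlinarith
    nlinarith [mul_nonneg (sub_nonneg.2 hu) (sub_nonneg.2 hv)]
  exact le_of_mul_le_mul_right ((mul_le_mul_of_nonneg_left h9 hA).trans h8) hp

lemma TripleData.double_lower_ratio {lam : ℝ} (h : TripleData 1 (1 + lam ^ 2 / 4) a b c a' b' c')
    (hd : d = 2 * a * c - b) (hd' : d' = 2 * (a' * c + a * c') - b') (he : e = 2 * d * a - c)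
    (he' : e' = 2 * (d' * a + d * a') - c') (hDd : 1 < ‖d‖) (hD : ‖e‖ ≤ 1) (hl : 8 < lam) :
    (lam - 4) * ‖a'‖ ≤ ‖e'‖ := by
  obtain ⟨e1, e2, ha1⟩ := h.double_norm_le_one hd he hDd hD
  obtain ⟨⟨h1, h2, h3⟩, ⟨h4, h5⟩, h6, h7⟩ := h.double_bounds hd he hD
  have h8 := h.double_lower hd hd' he he' hD
  have hc := h.norm_c
  have ha := norm_nonneg a
  have hA := norm_nonneg a'
  have hw0 := norm_nonneg (4 * a ^ 2 - 1)
  generalize ‖a‖ = α at *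
  generalize ‖4 * a ^ 2 - 1‖ = w at *
  generalize ‖c‖ = u at *
  generalize ‖d‖ = v at *
  have ha2 : α ^ 2 ≤ 1 := by nlinarith
  have hu : lam / 2 - 1 ≤ u := by nlinarith
  have hv : lam / 2 - 1 ≤ v := by nlinarith
  have hw : w ≤ 1 := by nlinarith
  have hp : 0 < u + 1 * α := by linarith
  have h9 : (lam - 4) * (u + 1 * α) ≤ 4 * u * v - 1 ^ 2 - α * w - (v + 1 * α) := by
    have e3 : α * w ≤ 1 := by nlinarith
    have e4 : (lam - 4) * (u + 1 * α) ≤ (2 * v - 2) * (u + 1) := by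
      apply mul_le_mul <;> linarith
    nlinarith
  refine le_of_mul_le_mul_right ?_ hp
  calc (lam - 4) * ‖a'‖ * (u + 1 * α) = ‖a'‖ * ((lam - 4) * (u + 1 * α)) := by ring
    _ ≤ _ := (mul_le_mul_of_nonneg_left h9 hA).trans h8

/-- Completing the square in `c` gives (c - ab)² = (1 - a²)(1 - b²) + λ²/4, where for real `a`, `b`
the product lies in [0, 1]. -/
lemma TripleData.norm_sub_mul_bounds {lam : ℝ}
    (h : TripleData 1 (1 + lam ^ 2 / 4) a b c a' b' c') (ha : a.im = 0) (hb : b.im = 0) :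
    lam ^ 2 / 4 ≤ ‖c - a * b‖ ^ 2 ∧ ‖c - a * b‖ ^ 2 ≤ lam ^ 2 / 4 + 1 := by
  obtain ⟨x, rfl⟩ : ∃ x : ℝ, a = x := ⟨a.re, Complex.ext rfl (by simp [ha])⟩
  obtain ⟨y, rfl⟩ : ∃ y : ℝ, b = y := ⟨b.re, Complex.ext rfl (by simp [hb])⟩
  have hx := h.norm_a
  have hy := h.norm_b
  rw [Complex.norm_real, Real.norm_eq_abs, ← sq_le_one_iff_abs_le_one] at hx hy
  have h1 : (c - x * y) ^ 2 = (((1 - x ^ 2) * (1 - y ^ 2) + lam ^ 2 / 4 : ℝ) : ℂ) := by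
    have := h.inv
    push_cast at this ⊢
    linear_combination this
  have h2 : 0 ≤ (1 - x ^ 2) * (1 - y ^ 2) := mul_nonneg (by linarith) (by linarith)
  rw [← norm_pow, h1, Complex.norm_real, Real.norm_of_nonneg (by positivity)]
  refine ⟨by linarith, ?_⟩
  nlinarith [sq_nonneg x, sq_nonneg y]

lemma TripleData.double_upper_ratio {lam : ℝ} (h : TripleData 1 (1 + lam ^ 2 / 4) a b c a' b' c')
    (hd : d = 2 * a * c - b) (hd' : d' = 2 * (a' * c + a * c') - b') (he : e = 2 * d * a - c)
    (he' : e' = 2 * (d' * a + d * a') - c') (hDd : 1 < ‖d‖) (hD : ‖e‖ ≤ 1)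
    (hl0 : 4 < lam) (ha : a.im = 0) (hb : b.im = 0) :
    ‖e'‖ ≤ Su lam * ‖a'‖ := by
  obtain ⟨e1, -, ha1⟩ := h.double_norm_le_one hd he hDd hD
  obtain ⟨r1, r2⟩ := h.norm_sub_mul_bounds ha hb
  have hb1 := h.norm_b
  have hA := norm_nonneg a'
  set R := c - a * b with hR
  have hRl : lam / 2 ≤ ‖R‖ := abs_le_of_sq_le_sq' (by linarith) (norm_nonneg _) |>.2
  have hRu : ‖R‖ ≤ lam / 2 + 1 / 4 := by
    refine abs_le_of_sq_le_sq' ?_ (by linarith) |>.2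
    nlinarith
  have hR2 : 2 ≤ ‖R‖ := by linarith
  have hu : ‖c‖ ≤ ‖R‖ + 1 := by
    have : c = R + a * b := by rw [hR]; ring
    rw [this]
    refine (norm_add_le _ _).trans ?_
    rw [norm_mul]
    gcongr
    exact mul_le_one₀ ha1 (norm_nonneg _) hb1
  have hsq : ∀ x : ℂ, x.im = 0 → ‖x‖ ≤ 1 → ‖1 - x ^ 2‖ ≤ 1 := by
    intro x hx hx1
    obtain ⟨x, rfl⟩ : ∃ y : ℝ, x = y := ⟨x.re, Complex.ext rfl (by simp [hx])⟩
    rw [Complex.norm_real, Real.norm_eq_abs, ← sq_le_one_iff_abs_le_one] at hx1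
    have : (1 - (x : ℂ) ^ 2) = ((1 - x ^ 2 : ℝ) : ℂ) := by push_cast; ring
    rw [this, Complex.norm_real, Real.norm_of_nonneg (by linarith)]
    linarith [sq_nonneg x]
  have hbound : ∀ x y : ℂ, ‖x‖ ≤ 1 → ‖y‖ ≤ 1 → y.im = 0 → ‖y * R - x * (1 - y ^ 2)‖ ≤ ‖R‖ + 1 := by
    intro x y hx hy hy0
    refine (norm_sub_le _ _).trans ?_
    rw [norm_mul, norm_mul]
    have := mul_le_mul hx (hsq y hy0 hy) (norm_nonneg _) zero_le_one
    nlinarith [norm_nonneg R]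
  have hc1 : c' * R = a' * (b * R - a * (1 - b ^ 2)) + b' * (a * R - b * (1 - a ^ 2)) := by
    rw [hR]; linear_combination h.deriv_inv
  have hc2 : ‖c'‖ * ‖R‖ ≤ ‖a'‖ * (‖R‖ + 1) + ‖a'‖ * (‖R‖ + 1) := by
    rw [← norm_mul, hc1]
    refine (norm_add_le _ _).trans ?_
    rw [norm_mul, norm_mul]
    have k1 := hbound a b h.norm_a hb1 hb
    have k2 := hbound b a hb1 h.norm_a ha
    have := h.deriv_le
    gcongr
  have hc3 : ‖c'‖ ≤ 3 * ‖a'‖ := by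
    refine le_of_mul_le_mul_right ?_ (by linarith : 0 < ‖R‖)
    nlinarith
  have hw : ‖4 * a ^ 2 - 1‖ ≤ 3 := by
    obtain ⟨x, rfl⟩ : ∃ y : ℝ, a = y := ⟨a.re, Complex.ext rfl (by simp [ha])⟩
    have hx := h.norm_a
    rw [Complex.norm_real, Real.norm_eq_abs, ← sq_le_one_iff_abs_le_one] at hx
    have : (4 * (x : ℂ) ^ 2 - 1) = ((4 * x ^ 2 - 1 : ℝ) : ℂ) := by push_cast; ring
    rw [this, Complex.norm_real, Real.norm_eq_abs, abs_le]
    constructor <;> nlinarith [sq_nonneg x]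
  have hee : e' = a' * (8 * a * c - 2 * b) + (4 * a ^ 2 - 1) * c' - 2 * a * b' := by
    rw [he', hd', hd]; ring
  have t1 : ‖8 * a * c - 2 * b‖ ≤ 4 * (‖c‖ + 1) + 2 := by
    refine (norm_sub_le _ _).trans ?_
    simp only [norm_mul, Complex.norm_ofNat]
    linarith
  have t2 : ‖e'‖ ≤ ‖a'‖ * ‖8 * a * c - 2 * b‖ + ‖4 * a ^ 2 - 1‖ * ‖c'‖ + 2 * ‖a‖ * ‖b'‖ := by
    rw [hee]
    refine (norm_sub_le _ _).trans ?_
    refine (add_le_add_left (norm_add_le _ _) _).trans ?_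
    simp
  have t3 : ‖4 * a ^ 2 - 1‖ * ‖c'‖ ≤ 3 * (3 * ‖a'‖) := mul_le_mul hw hc3 (norm_nonneg _) (by norm_num)
  have t4 : ‖a‖ * ‖b'‖ ≤ 1 * ‖a'‖ := mul_le_mul ha1 h.deriv_le (norm_nonneg _) zero_le_one
  have t5 := mul_le_mul_of_nonneg_left t1 hA
  -- The terms add up to 4|c| + 17 ≤ 4|R| + 21 ≤ 2λ + 22, with no slack left in the constant 22.
  unfold Su
  nlinarith

end Double

end FibonacciHamiltonian

/-! ### Trace polynomials and the chain of bounded half traces. -/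

namespace FibonacciHamiltonian

open Polynomial

/-- The half traces as polynomials, shifted by one and preceded by the constant `x_{-1} = 1`. -/
noncomputable def tracePoly (lam : ℝ) : ℕ → ℂ[X]
  | 0 => 1
  | 1 => C (1 / 2) * X
  | 2 => C (1 / 2) * (X - C (lam : ℂ))
  | n + 3 => 2 * tracePoly lam (n + 2) * tracePoly lam (n + 1) - tracePoly lam n

/-- The value of `tracePoly` at `z`. -/
noncomputable def traceVal (lam : ℝ) (z : ℂ) (n : ℕ) : ℂ := (tracePoly lam n).eval z

/-- The derivative of `tracePoly` at `z`. -/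
noncomputable def traceDer (lam : ℝ) (z : ℂ) (n : ℕ) : ℂ := (derivative (tracePoly lam n)).eval z

section

variable (lam : ℝ) (z : ℂ)

@[simp] lemma traceVal_zero : traceVal lam z 0 = 1 := by simp [traceVal, tracePoly]
@[simp] lemma traceVal_one : traceVal lam z 1 = z / 2 := by
  simp [traceVal, tracePoly]; ring
@[simp] lemma traceVal_two : traceVal lam z 2 = (z - lam) / 2 := by
  simp [traceVal, tracePoly]; ring
lemma traceVal_add_three (n : ℕ) : traceVal lam z (n + 3) =
    2 * traceVal lam z (n + 2) * traceVal lam z (n + 1) - traceVal lam z n := by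
  simp [traceVal, tracePoly]
@[simp] lemma traceDer_zero : traceDer lam z 0 = 0 := by simp [traceDer, tracePoly]
@[simp] lemma traceDer_one : traceDer lam z 1 = 1 / 2 := by
  simp [traceDer, tracePoly, derivative_mul]
@[simp] lemma traceDer_two : traceDer lam z 2 = 1 / 2 := by
  simp [traceDer, tracePoly, derivative_mul]
lemma traceDer_add_three (n : ℕ) : traceDer lam z (n + 3) =
    2 * (traceDer lam z (n + 2) * traceVal lam z (n + 1) +
      traceVal lam z (n + 2) * traceDer lam z (n + 1)) - traceDer lam z n := by
  simp [traceDer, traceVal, tracePoly, derivative_mul]; ring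

lemma traceVal_invariant (n : ℕ) :
    traceVal lam z n ^ 2 + traceVal lam z (n + 1) ^ 2 + traceVal lam z (n + 2) ^ 2 -
      2 * traceVal lam z n * traceVal lam z (n + 1) * traceVal lam z (n + 2) =
      ((1 + lam ^ 2 / 4 : ℝ) : ℂ) := by
  induction n with
  | zero => push_cast; simp; ring
  | succ n ih =>
    rw [← ih, traceVal_add_three lam z n]; ring

lemma traceDer_invariant (n : ℕ) :
    traceVal lam z n * traceDer lam z n + traceVal lam z (n + 1) * traceDer lam z (n + 1) +
      traceVal lam z (n + 2) * traceDer lam z (n + 2) -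
      (traceDer lam z n * traceVal lam z (n + 1) * traceVal lam z (n + 2) +
        traceVal lam z n * traceDer lam z (n + 1) * traceVal lam z (n + 2) +
        traceVal lam z n * traceVal lam z (n + 1) * traceDer lam z (n + 2)) = 0 := by
  induction n with
  | zero => simp; ring
  | succ n ih =>
    rw [traceVal_add_three lam z n, traceDer_add_three lam z n]
    linear_combination ih

lemma tracePoly_eval_conj (n : ℕ) :
    (tracePoly lam n).eval (starRingEnd ℂ z) = starRingEnd ℂ ((tracePoly lam n).eval z) := by
  suffices ∀ n, traceVal lam (starRingEnd ℂ z) n = starRingEnd ℂ (traceVal lam z n) from this n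
  intro n
  induction n using Nat.strong_induction_on with
  | _ n ih =>
    match n with
    | 0 => simp
    | 1 => simp [Complex.conj_ofNat]
    | 2 => simp [Complex.conj_ofNat]
    | n + 3 =>
      rw [traceVal_add_three, traceVal_add_three, ih n (by omega), ih (n + 1) (by omega),
        ih (n + 2) (by omega)]
      simp [Complex.conj_ofNat]

lemma traceVal_im_eq_zero (hz : z.im = 0) (n : ℕ) : (traceVal lam z n).im = 0 := by
  have h := tracePoly_eval_conj lam z n
  rw [Complex.conj_eq_iff_im.2 hz] at h
  exact Complex.conj_eq_iff_im.1 h.symm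

end

section Chain

variable {lam D : ℝ} {z : ℂ}

/-- Three values bounded by D would force K ≤ 3D² + 2D³. -/
lemma not_three_small (hD1 : 1 ≤ D) (hK : 2 + 3 * D ^ 2 + 2 * D ^ 3 ≤ 1 + lam ^ 2 / 4) (n : ℕ)
    (h0 : ‖traceVal lam z n‖ ≤ D) (h1 : ‖traceVal lam z (n + 1)‖ ≤ D) :
    D < ‖traceVal lam z (n + 2)‖ := by
  by_contra! h2
  have h := traceVal_invariant lam z n
  generalize traceVal lam z n = a at *
  generalize traceVal lam z (n + 1) = b at *
  generalize traceVal lam z (n + 2) = c at *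
  have e : ‖((1 + lam ^ 2 / 4 : ℝ) : ℂ)‖ ≤ ‖a‖ ^ 2 + ‖b‖ ^ 2 + ‖c‖ ^ 2 + 2 * ‖a‖ * ‖b‖ * ‖c‖ := by
    rw [← h]
    refine (norm_sub_le _ _).trans ?_
    simp only [norm_mul, Complex.norm_ofNat]
    gcongr
    simp only [← norm_pow]
    exact norm_add₃_le
  rw [Complex.norm_real, Real.norm_of_nonneg (by positivity)] at e
  have : ‖a‖ ^ 2 + ‖b‖ ^ 2 + ‖c‖ ^ 2 + 2 * ‖a‖ * ‖b‖ * ‖c‖ ≤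
      D ^ 2 + D ^ 2 + D ^ 2 + 2 * D * D * D := by gcongr
  nlinarith

/-- The escape property: after one bounded and two large half traces, all later ones are large. -/
lemma escape (hD1 : 1 ≤ D) (n : ℕ) (h0 : ‖traceVal lam z n‖ ≤ D)
    (h1 : D < ‖traceVal lam z (n + 1)‖) (h2 : D < ‖traceVal lam z (n + 2)‖) (m : ℕ) :
    D < ‖traceVal lam z (n + 1 + m)‖ := by
  -- The third conjunct absorbs the subtracted term: |x_{m+3}| ≥ |x_{m+2}| (2|x_{m+1}| - 1), which
  -- exceeds D and |x_{m+1}|.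
  suffices ∀ m, D < ‖traceVal lam z (n + 1 + m)‖ ∧ D < ‖traceVal lam z (n + 2 + m)‖ ∧
      ‖traceVal lam z (n + m)‖ ≤ ‖traceVal lam z (n + 2 + m)‖ from (this m).1
  intro m
  induction m with
  | zero => exact ⟨h1, h2, h0.trans h2.le⟩
  | succ m ih =>
    obtain ⟨a1, a2, a3⟩ := ih
    refine ⟨by convert a2 using 3; ring, ?_⟩
    have e : traceVal lam z (n + 2 + (m + 1)) = 2 * traceVal lam z (n + 2 + m) *
        traceVal lam z (n + 1 + m) - traceVal lam z (n + m) := by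
      have := traceVal_add_three lam z (n + m)
      convert this using 2 <;> ring_nf
    have e2 := norm_sub_norm_le (2 * traceVal lam z (n + 2 + m) * traceVal lam z (n + 1 + m))
      (traceVal lam z (n + m))
    rw [← e] at e2
    simp only [norm_mul, Complex.norm_ofNat] at e2
    rw [show n + (m + 1) = n + 1 + m by ring]
    constructor <;> nlinarith

/-- `IsPred lam D z j n`: the index `j` is the last one before `n` whose half trace is bounded
by `D`, and it is `n - 1` or `n - 2`. -/
def IsPred (lam D : ℝ) (z : ℂ) (j n : ℕ) : Prop :=
  ‖traceVal lam z j‖ ≤ D ∧ (n = j + 1 ∨ n = j + 2 ∧ D < ‖traceVal lam z (j + 1)‖)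

/-- Were the two preceding values large, the last bounded one before them would start an escape
reaching `n`. Such a value exists because index 0 carries the constant 1. -/
lemma exists_isPred (hD1 : 1 ≤ D) {n : ℕ} (hn : 1 ≤ n) (h : ‖traceVal lam z n‖ ≤ D) :
    ∃ j, IsPred lam D z j n := by
  by_contra! hno
  have key : ∀ i, i < n → D < ‖traceVal lam z (n - 1 - i)‖ := by
    intro i
    induction i using Nat.strong_induction_on with
    | _ i ih =>
      intro hi
      by_contra! hs
      match i with
      | 0 => exact hno (n - 1) ⟨hs, Or.inl (by omega)⟩
      | 1 =>
        refine hno (n - 2) ⟨hs, Or.inr ⟨by omega, ?_⟩⟩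
        have := ih 0 (by omega) (by omega)
        rwa [show n - 1 - 0 = n - 2 + 1 by omega] at this
      | i + 2 =>
        have a1 := ih (i + 1) (by omega) (by omega)
        have a2 := ih i (by omega) (by omega)
        have := escape hD1 (n - 1 - (i + 2)) hs
          (by rwa [show n - 1 - (i + 2) + 1 = n - 1 - (i + 1) by omega])
          (by rwa [show n - 1 - (i + 2) + 2 = n - 1 - i by omega]) (i + 2)
        rw [show n - 1 - (i + 2) + 1 + (i + 2) = n by omega] at this
        linarith
  have := key (n - 1) (by omega)
  simp at this
  linarith

/-- The algebraic content of a step from a bounded half trace to the next bounded one, in one of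
its two forms. -/
def ChainStep (lam D : ℝ) (z : ℂ) (j n : ℕ) : Prop :=
  ∃ p q : ℕ, TripleData D (1 + lam ^ 2 / 4) (traceVal lam z j) (traceVal lam z p)
      (traceVal lam z q) (traceDer lam z j) (traceDer lam z p) (traceDer lam z q) ∧
    ‖traceVal lam z n‖ ≤ D ∧
    ((traceVal lam z n = 2 * traceVal lam z q * traceVal lam z j - traceVal lam z p ∧
      traceDer lam z n = 2 * (traceDer lam z q * traceVal lam z j +
        traceVal lam z q * traceDer lam z j) - traceDer lam z p) ∨
    ∃ r, D < ‖traceVal lam z r‖ ∧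
      (traceVal lam z r = 2 * traceVal lam z j * traceVal lam z q - traceVal lam z p ∧
      traceDer lam z r = 2 * (traceDer lam z j * traceVal lam z q +
        traceVal lam z j * traceDer lam z q) - traceDer lam z p) ∧
      traceVal lam z n = 2 * traceVal lam z r * traceVal lam z j - traceVal lam z q ∧
      traceDer lam z n = 2 * (traceDer lam z r * traceVal lam z j +
        traceVal lam z r * traceDer lam z j) - traceDer lam z q)

lemma ChainStep.growth {j n : ℕ} (h : ChainStep lam D z j n) (hD1 : 1 ≤ D)
    (hK : 2 + 3 * D ^ 2 + 2 * D ^ 3 ≤ 1 + lam ^ 2 / 4) :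
    ‖traceDer lam z j‖ ≤ ‖traceDer lam z n‖ := by
  obtain ⟨p, q, ht, hn, ⟨h1, h2⟩ | ⟨r, hr, ⟨h1, h2⟩, h3, h4⟩⟩ := h
  · exact ht.simple_growth h1 h2 hn hD1 hK
  · exact ht.double_growth h1 h2 h3 h4 hr hn hD1 hK

lemma ChainStep.lower {j n : ℕ} (h : ChainStep lam 1 z j n) (hl : 8 < lam) :
    (lam - 4) * ‖traceDer lam z j‖ ≤ ‖traceDer lam z n‖ := by
  obtain ⟨p, q, ht, hn, ⟨h1, h2⟩ | ⟨r, hr, ⟨h1, h2⟩, h3, h4⟩⟩ := h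
  · exact ht.simple_lower_ratio h1 h2 hn hl
  · exact ht.double_lower_ratio h1 h2 h3 h4 hr hn hl

lemma ChainStep.upper {j n : ℕ} (h : ChainStep lam 1 z j n) (hl0 : 4 < lam) (hl : 24 < lam ^ 2)
    (hz : z.im = 0) : ‖traceDer lam z n‖ ≤ Su lam * ‖traceDer lam z j‖ := by
  obtain ⟨p, q, ht, hn, ⟨h1, h2⟩ | ⟨r, hr, ⟨h1, h2⟩, h3, h4⟩⟩ := h
  · exact ht.simple_upper_ratio h1 h2 hn hl0 hl
  · exact ht.double_upper_ratio h1 h2 h3 h4 hr hn hl0 (traceVal_im_eq_zero _ _ hz _)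
      (traceVal_im_eq_zero _ _ hz _)

lemma tripleData_of_growth (hD1 : 1 ≤ D) (hK : 2 + 3 * D ^ 2 + 2 * D ^ 3 ≤ 1 + lam ^ 2 / 4)
    {i j : ℕ} (hj : ‖traceVal lam z j‖ ≤ D) (hi : IsPred lam D z i j)
    (hg : ‖traceDer lam z i‖ ≤ ‖traceDer lam z j‖) :
    ∃ q, (j = i + 1 ∧ q = i + 2 ∨ j = i + 2 ∧ q = i + 1) ∧
      TripleData D (1 + lam ^ 2 / 4) (traceVal lam z j) (traceVal lam z i)
      (traceVal lam z q) (traceDer lam z j) (traceDer lam z i) (traceDer lam z q) := by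
  have e1 := traceVal_invariant lam z i
  have e2 := traceDer_invariant lam z i
  obtain ⟨hi0, rfl | ⟨rfl, hb⟩⟩ := hi
  · refine ⟨i + 2, by simp, hj, hi0, not_three_small hD1 hK i hi0 hj, hg, ?_, ?_⟩
    · rw [← e1]; ring
    · linear_combination e2
  · refine ⟨i + 1, by simp, hj, hi0, hb, hg, ?_, ?_⟩
    · rw [← e1]; ring
    · linear_combination e2

/-- A bounded half trace has derivative at least `1 / 2`, and consecutive bounded half traces are
linked by a `ChainStep`. -/
lemma chain (hD1 : 1 ≤ D) (hK : 2 + 3 * D ^ 2 + 2 * D ^ 3 ≤ 1 + lam ^ 2 / 4) (n : ℕ)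
    (hn : 1 ≤ n) (h : ‖traceVal lam z n‖ ≤ D) :
    1 / 2 ≤ ‖traceDer lam z n‖ ∧ ∀ j, IsPred lam D z j n →
      ‖traceDer lam z j‖ ≤ ‖traceDer lam z n‖ ∧ (1 ≤ j → ChainStep lam D z j n) := by
  induction n using Nat.strong_induction_on with
  | _ n ih =>
    have step : ∀ j, 1 ≤ j → IsPred lam D z j n → ChainStep lam D z j n := by
      intro j hj1 hj
      have hjn : j < n := by rcases hj.2 with h | h <;> omega
      obtain ⟨i, hi⟩ := exists_isPred hD1 hj1 hj.1
      have hg := ((ih j hjn hj1 hj.1).2 i hi).1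
      obtain ⟨q, hq, ht⟩ := tripleData_of_growth hD1 hK hj.1 hi hg
      refine ⟨i, q, ht, h, ?_⟩
      -- Cases by the gaps after and before `j`: 1 and 1 is impossible, one gap of each kind passes
      -- one large value, 2 and 2 passes two.
      obtain ⟨hj0, hjn' | ⟨hjn', hb⟩⟩ := hj
      · obtain ⟨rfl, rfl⟩ | ⟨rfl, rfl⟩ := hq
        · subst hjn'
          have := not_three_small hD1 hK i hi.1 hj0
          exact absurd h (not_le.2 this)
        · subst hjn'
          left
          refine ⟨?_, ?_⟩
          · rw [traceVal_add_three]; ring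
          · rw [traceDer_add_three]; ring
      · obtain ⟨rfl, rfl⟩ | ⟨rfl, rfl⟩ := hq
        · subst hjn'
          left
          exact ⟨traceVal_add_three _ _ _, traceDer_add_three _ _ _⟩
        · subst hjn'
          right
          exact ⟨i + 3, hb, ⟨traceVal_add_three _ _ _, traceDer_add_three _ _ _⟩,
            traceVal_add_three _ _ (i + 1), traceDer_add_three _ _ (i + 1)⟩
    have grow : ∀ j, IsPred lam D z j n → ‖traceDer lam z j‖ ≤ ‖traceDer lam z n‖ := by
      intro j hj
      -- The start of the chain is constant, so its derivative vanishes and growth is trivial; the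
      -- first genuine link is x_0 or x_1, with derivative 1/2.
      rcases Nat.eq_zero_or_pos j with rfl | hj1
      · simp
      · exact (step j hj1 hj).growth hD1 hK
    refine ⟨?_, fun j hj => ⟨grow j hj, fun h1 => step j h1 hj⟩⟩
    obtain ⟨j, hj⟩ := exists_isPred hD1 hn h
    rcases Nat.eq_zero_or_pos j with rfl | hj1
    · rcases hj.2 with rfl | ⟨rfl, -⟩ <;> simp
    · exact ((ih j (by rcases hj.2 with h | h <;> omega) hj1 hj.1).1).trans (grow j hj)

/-- The number of indices `1 ≤ l < n` with `|traceVal l| ≤ 1`. -/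
noncomputable def smallCount (lam : ℝ) (z : ℂ) (n : ℕ) : ℕ :=
  ((Finset.range (n - 1)).filter (fun l => ‖traceVal lam z (l + 1)‖ ≤ 1)).card

lemma smallCount_isPred {j n : ℕ} (h : IsPred lam 1 z j n) (hj : 1 ≤ j) :
    smallCount lam z n = smallCount lam z j + 1 := by
  obtain ⟨j, rfl⟩ : ∃ i, j = i + 1 := ⟨j - 1, by omega⟩
  obtain ⟨h0, rfl | ⟨rfl, hb⟩⟩ := h
  · simp [smallCount, Finset.range_add_one, Finset.filter_insert, h0]
  · simp [smallCount, Finset.range_add_one, Finset.filter_insert, h0, not_le.2 hb]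

lemma smallCount_isPred_zero {n : ℕ} (h : IsPred lam 1 z 0 n) :
    smallCount lam z n = 0 := by
  obtain ⟨h0, rfl | ⟨rfl, hb⟩⟩ := h
  · simp [smallCount]
  · simp [smallCount, Finset.filter_eq_empty_iff] at hb ⊢
    exact hb

/-- The first link has derivative 1/2 and count 0; each further link gains a factor λ - 4 and raises
the count by one. -/
lemma traceDer_lower (hl : 8 < lam) (n : ℕ) (hn : 1 ≤ n) (h : ‖traceVal lam z n‖ ≤ 1) :
    1 / 2 * (lam - 4) ^ smallCount lam z n ≤ ‖traceDer lam z n‖ := by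
  have hK : 2 + 3 * (1 : ℝ) ^ 2 + 2 * 1 ^ 3 ≤ 1 + lam ^ 2 / 4 := by nlinarith
  induction n using Nat.strong_induction_on with
  | _ n ih =>
    obtain ⟨c1, c2⟩ := chain le_rfl hK n hn h
    obtain ⟨j, hj⟩ := exists_isPred le_rfl hn h
    rcases Nat.eq_zero_or_pos j with rfl | hj1
    · rw [smallCount_isPred_zero hj]; simpa using c1
    · have := ih j (by rcases hj.2 with h | h <;> omega) hj1 hj.1
      have h2 := ((c2 j hj).2 hj1).lower hl
      rw [smallCount_isPred hj hj1, pow_succ]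
      nlinarith

lemma traceDer_upper (hl0 : 4 < lam) (hl : 24 < lam ^ 2) (hz : z.im = 0) (n : ℕ) (hn : 1 ≤ n)
    (h : ‖traceVal lam z n‖ ≤ 1) :
    ‖traceDer lam z n‖ ≤ 1 / 2 * Su lam ^ smallCount lam z n := by
  have hK : 2 + 3 * (1 : ℝ) ^ 2 + 2 * 1 ^ 3 ≤ 1 + lam ^ 2 / 4 := by nlinarith
  induction n using Nat.strong_induction_on with
  | _ n ih =>
    obtain ⟨c1, c2⟩ := chain le_rfl hK n hn h
    obtain ⟨j, hj⟩ := exists_isPred le_rfl hn h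
    rcases Nat.eq_zero_or_pos j with rfl | hj1
    · rw [smallCount_isPred_zero hj]
      rcases hj.2 with rfl | ⟨rfl, -⟩ <;> simp
    · have := ih j (by rcases hj.2 with h | h <;> omega) hj1 hj.1
      have h2 := ((c2 j hj).2 hj1).upper hl0 hl hz
      have hS : 0 ≤ Su lam := by unfold Su; linarith
      rw [smallCount_isPred hj hj1, pow_succ]
      nlinarith

end Chain

end FibonacciHamiltonian

/-! ### Distortion of typically real functions. -/

namespace FibonacciHamiltonian

open Polynomial Metric Set

section TypicallyReal

variable {f : ℂ → ℂ} {r R : ℝ}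

/-- A function on a disc whose imaginary part has the sign of the imaginary part of the variable
satisfies a distortion estimate. -/
lemma typicallyReal_estimate (hr : 0 < r) (hrR : r < R) (hf : DifferentiableOn ℂ f (ball 0 R))
    (h0 : f 0 = 0) (hd : deriv f 0 ≠ 0) (hsign : ∀ z ∈ ball (0 : ℂ) R, 0 ≤ (f z).im * z.im)
    {z : ℂ} (hz : ‖z‖ < r) :
    ‖(r ^ 2 - z ^ 2) * dslope f 0 z - r ^ 2 * deriv f 0‖ ≤
      2 * (r ^ 2 * ‖deriv f 0‖) * ‖z‖ / (r - ‖z‖) := by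
  have hR : 0 < R := hr.trans hrR
  set g : ℂ → ℂ := fun z => (r ^ 2 - z ^ 2) * dslope f 0 z with hg
  have hgd : DifferentiableOn ℂ g (ball 0 R) := by
    refine DifferentiableOn.mul (by fun_prop) ?_
    exact (Complex.differentiableOn_dslope (ball_mem_nhds 0 hR)).2 hf
  have hfr : ∀ z ∈ sphere (0 : ℂ) r, 0 ≤ (g z).re := by
    intro z hz
    have hzr : ‖z‖ = r := by simpa using hz
    have hz0 : z ≠ 0 := by rintro rfl; simp at hzr; linarith
    -- On the circle r² equals z times its conjugate, so Re g = 2 Im z · Im f ≥ 0.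
    have h1 : g z = (starRingEnd ℂ z - z) * f z := by
      simp only [hg]
      rw [dslope_of_ne _ hz0, slope_def_field, h0]
      have : (r : ℂ) ^ 2 = starRingEnd ℂ z * z := by
        rw [← Complex.normSq_eq_conj_mul_self, Complex.normSq_eq_norm_sq, hzr]; push_cast; rfl
      rw [this]; field_simp; ring
    have h2 := hsign z (by simp [hzr, hrR])
    rw [h1]
    simp only [Complex.mul_re, Complex.sub_re, Complex.sub_im, Complex.conj_re, Complex.conj_im]
    nlinarith
  have hcl : closure (ball (0 : ℂ) r) ⊆ ball 0 R := by
    rw [closure_ball _ hr.ne']; exact closedBall_subset_ball hrR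
  have hpos : ∀ z ∈ ball (0 : ℂ) r, 0 ≤ (g z).re := by
    intro z hz
    -- The maximum principle for exp(-g) carries Re g ≥ 0 into the disc.
    have h1 : DiffContOnCl ℂ (fun z => Complex.exp (-g z)) (ball 0 r) := by
      apply DifferentiableOn.diffContOnCl
      exact ((hgd.mono hcl).neg).cexp
    have h2 : ‖Complex.exp (-g z)‖ ≤ 1 := by
      refine Complex.norm_le_of_forall_mem_frontier_norm_le isBounded_ball h1 ?_ (subset_closure hz)
      intro w hw
      rw [frontier_ball _ hr.ne'] at hw
      simpa [Complex.norm_exp] using hfr w hw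
    simpa [Complex.norm_exp] using h2
  have hg0 : g 0 = r ^ 2 * deriv f 0 := by simp [hg]
  have hn0 : ‖g 0‖ = r ^ 2 * ‖deriv f 0‖ := by rw [hg0]; simp
  have key := Complex.borelCaratheodory_zero (f := fun z => g 0 - g z) (M := ‖g 0‖) (R := r)
    (by rw [hn0]; positivity)
    ((differentiableOn_const _).sub (hgd.mono (ball_subset_ball hrR.le)))
    (fun w hw => by
      have := hpos w hw
      have := Complex.re_le_norm (g 0)
      simp only [mem_ofPred_eq, Complex.sub_re]; linarith) hr (by simpa using hz) (by simp)
  rw [hn0, norm_sub_rev, hg0] at key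
  exact key

lemma typicallyReal_upper (hr : 0 < r) (hrR : r < R) (hf : DifferentiableOn ℂ f (ball 0 R))
    (h0 : f 0 = 0) (hd : deriv f 0 ≠ 0) (hsign : ∀ z ∈ ball (0 : ℂ) R, 0 ≤ (f z).im * z.im)
    {s : ℝ} (hs : s < r) {z : ℂ} (hz : ‖z‖ ≤ s) :
    ‖f z‖ ≤ s * (r ^ 2 * (1 + 2 * s / (r - s)) / (r ^ 2 - s ^ 2)) * ‖deriv f 0‖ := by
  have key := typicallyReal_estimate hr hrR hf h0 hd hsign (hz.trans_lt hs)
  have hz0 := norm_nonneg z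
  have hs0 := hz0.trans hz
  have hp : 0 < r ^ 2 - s ^ 2 := by nlinarith
  have h1 : 2 * (r ^ 2 * ‖deriv f 0‖) * ‖z‖ / (r - ‖z‖) ≤
      2 * (r ^ 2 * ‖deriv f 0‖) * s / (r - s) := by
    gcongr
  have h2 : ‖(r ^ 2 - z ^ 2) * dslope f 0 z‖ ≤
      r ^ 2 * ‖deriv f 0‖ + 2 * (r ^ 2 * ‖deriv f 0‖) * s / (r - s) := by
    have := norm_sub_norm_le ((r ^ 2 - z ^ 2) * dslope f 0 z) (r ^ 2 * deriv f 0)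
    have e : ‖(r : ℂ) ^ 2 * deriv f 0‖ = r ^ 2 * ‖deriv f 0‖ := by simp
    rw [e] at this
    linarith
  have h3 : r ^ 2 - s ^ 2 ≤ ‖(r : ℂ) ^ 2 - z ^ 2‖ := by
    have := norm_sub_norm_le ((r : ℂ) ^ 2) (z ^ 2)
    simp only [norm_pow, Complex.norm_real, Real.norm_eq_abs, sq_abs] at this
    nlinarith
  have h4 : ‖dslope f 0 z‖ ≤ r ^ 2 * (1 + 2 * s / (r - s)) / (r ^ 2 - s ^ 2) * ‖deriv f 0‖ := by
    rw [div_mul_eq_mul_div, le_div_iff₀ hp]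
    rw [norm_mul] at h2
    calc ‖dslope f 0 z‖ * (r ^ 2 - s ^ 2) ≤ ‖(r : ℂ) ^ 2 - z ^ 2‖ * ‖dslope f 0 z‖ := by
          rw [mul_comm]; gcongr
      _ ≤ _ := h2
      _ = _ := by ring
  have h5 : f z = z * dslope f 0 z := by
    have := sub_smul_dslope f 0 z
    simpa [h0] using this.symm
  rw [h5, norm_mul, mul_assoc]
  gcongr

/-- At radius r/5 the error term is exactly half of the main term; dividing by |r² - z²| ≤ 2r²
leaves a quarter of the derivative, times r/5. -/
lemma typicallyReal_lower (hr : 0 < r) (hrR : r < R) (hf : DifferentiableOn ℂ f (ball 0 R))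
    (h0 : f 0 = 0) (hd : deriv f 0 ≠ 0) (hsign : ∀ z ∈ ball (0 : ℂ) R, 0 ≤ (f z).im * z.im)
    {z : ℂ} (hz : ‖z‖ = r / 5) : r / 20 * ‖deriv f 0‖ ≤ ‖f z‖ := by
  have key := typicallyReal_estimate hr hrR hf h0 hd hsign (by rw [hz]; linarith)
  have h1 : 2 * (r ^ 2 * ‖deriv f 0‖) * ‖z‖ / (r - ‖z‖) = r ^ 2 * ‖deriv f 0‖ / 2 := by
    rw [hz]; field_simp; norm_num
  have h2 : r ^ 2 * ‖deriv f 0‖ / 2 ≤ ‖((r : ℂ) ^ 2 - z ^ 2)‖ * ‖dslope f 0 z‖ := by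
    have := norm_sub_norm_le (r ^ 2 * deriv f 0) ((r ^ 2 - z ^ 2) * dslope f 0 z)
    have e : ‖(r : ℂ) ^ 2 * deriv f 0‖ = r ^ 2 * ‖deriv f 0‖ := by simp
    rw [e, norm_sub_rev, norm_mul] at this
    linarith
  have h3 : ‖(r : ℂ) ^ 2 - z ^ 2‖ ≤ 2 * r ^ 2 := by
    have := norm_sub_le ((r : ℂ) ^ 2) (z ^ 2)
    simp only [norm_pow, Complex.norm_real, Real.norm_eq_abs, sq_abs, hz] at this
    nlinarith
  have h5 : f z = z * dslope f 0 z := by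
    have := sub_smul_dslope f 0 z
    simpa [h0] using this.symm
  rw [h5, norm_mul, hz]
  have h6 : ‖deriv f 0‖ / 4 ≤ ‖dslope f 0 z‖ := by
    have := h2.trans (mul_le_mul_of_nonneg_right h3 (norm_nonneg _))
    have hr2 : 0 < r ^ 2 := by positivity
    nlinarith
  nlinarith

end TypicallyReal

/-! ### Inverse branches of polynomials over a disc free of critical values. -/

section InverseBranch

variable {p : ℂ[X]} {D : ℝ}

/-- A polynomial without critical points over a disc has inverse branches on that disc. -/
lemma exists_inverse_branch (hD : 0 < D) (hcrit : ∀ w, ‖p.eval w‖ < D → p.derivative.eval w ≠ 0)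
    {ζ w : ℂ} (hζ : ‖ζ‖ < D) (hw : p.eval w = ζ) :
    ∃ F : ℂ → ℂ, ContinuousOn F (ball 0 D) ∧ F ζ = w ∧ (∀ x ∈ ball (0 : ℂ) D, p.eval (F x) = x) ∧
      ∀ G : ℂ → ℂ, ContinuousOn G (ball 0 D) → G ζ = w → (∀ x ∈ ball (0 : ℂ) D, p.eval (G x) = x) →
        EqOn G F (ball 0 D) := by
  classical
  have hcov : IsCoveringMapOn p.eval (ball (0 : ℂ) D) := by
    -- A polynomial is a covering off its critical values; since the disc is contractible, its
    -- inclusion lifts uniquely once a base point is fixed.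
    refine p.isCoveringMapOn_eval.mono ?_
    rintro x hx ⟨w, hw, rfl⟩
    exact hcrit w (by simpa using hx) hw
  have : ContractibleSpace (ball (0 : ℂ) D) :=
    (convex_ball (0 : ℂ) D).contractibleSpace ⟨0, mem_ball_self hD⟩
  have : LocallyPathConnectedSpace (ball (0 : ℂ) D) := isOpen_ball.locallyPathConnectedSpace
  obtain ⟨F, ⟨hF1, hF2⟩, hF3⟩ := hcov.existsUnique_continuousMap_lifts
    (A := ball (0 : ℂ) D) ⟨Subtype.val, continuous_subtype_val⟩ (a₀ := ⟨ζ, by simpa using hζ⟩)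
    (e₀ := w) (by simpa using hw) (fun a => a.2)
  refine ⟨fun x => if hx : x ∈ ball (0 : ℂ) D then F ⟨x, hx⟩ else 0, ?_, ?_, ?_, ?_⟩
  · rw [continuousOn_iff_continuous_domRestrict]
    convert F.continuous using 1
    ext x
    have := x.2
    simp only [domRestrict_apply, dif_pos this]
  · have : ζ ∈ ball (0 : ℂ) D := by simpa using hζ
    simp only [dif_pos this, hF1]
  · intro x hx
    simp only [dif_pos hx]
    exact congrFun hF2 ⟨x, hx⟩
  · intro G hG hGw hGp x hx
    have := hF3 ⟨(ball (0 : ℂ) D).domRestrict G, continuousOn_iff_continuous_domRestrict.1 hG⟩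
      ⟨hGw, by ext x; exact hGp x x.2⟩
    simp only [dif_pos hx, ← this]
    rfl

/-- A continuous inverse branch is differentiable. -/
lemma inverse_branch_hasDerivAt (hcrit : ∀ w, ‖p.eval w‖ < D → p.derivative.eval w ≠ 0)
    {F : ℂ → ℂ} (hF : ContinuousOn F (ball 0 D)) (hpF : ∀ x ∈ ball (0 : ℂ) D, p.eval (F x) = x)
    {x : ℂ} (hx : x ∈ ball (0 : ℂ) D) : HasDerivAt F (p.derivative.eval (F x))⁻¹ x := by
  refine HasDerivAt.of_local_left_inverse (f := p.eval) (hF.continuousAt (isOpen_ball.mem_nhds hx))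
    (p.hasDerivAt _) (hcrit _ (by rw [hpF x hx]; simpa using hx)) ?_
  filter_upwards [isOpen_ball.mem_nhds hx] with y hy using hpF y hy

/-- A real polynomial without critical points over a disc: the inverse branch at a real zero
is typically real up to sign. -/
lemma inverse_branch_sign (hconj : ∀ w, p.eval (starRingEnd ℂ w) = starRingEnd ℂ (p.eval w))
    {F : ℂ → ℂ} (hF : ContinuousOn F (ball 0 D)) (hpF : ∀ x ∈ ball (0 : ℂ) D, p.eval (F x) = x)
    (huniq : ∀ G : ℂ → ℂ, ContinuousOn G (ball 0 D) → G 0 = F 0 →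
      (∀ x ∈ ball (0 : ℂ) D, p.eval (G x) = x) → EqOn G F (ball 0 D)) (h0 : (F 0).im = 0) :
    (∀ x ∈ ball (0 : ℂ) D, 0 ≤ (F x).im * x.im) ∨ (∀ x ∈ ball (0 : ℂ) D, 0 ≤ (-F x).im * x.im) := by
  have hball : ∀ x ∈ ball (0 : ℂ) D, starRingEnd ℂ x ∈ ball (0 : ℂ) D := by
    intro x hx; simpa using hx
  have hsymm : ∀ x ∈ ball (0 : ℂ) D, F (starRingEnd ℂ x) = starRingEnd ℂ (F x) := by
    -- Conjugating a branch on both sides gives a branch with the same real value at 0.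
    have := huniq (fun x => starRingEnd ℂ (F (starRingEnd ℂ x)))
      (Complex.continuous_conj.comp_continuousOn
        (hF.comp Complex.continuous_conj.continuousOn hball))
      (by simpa using Complex.conj_eq_iff_im.2 h0)
      (fun x hx => by rw [hconj, hpF _ (hball x hx), Complex.conj_conj])
    intro x hx
    rw [← this hx, Complex.conj_conj]
  have hne : ∀ x ∈ ball (0 : ℂ) D, x.im ≠ 0 → (F x).im ≠ 0 := by
    intro x hx hxi h
    have h1 := hconj (F x)
    rw [Complex.conj_eq_iff_im.2 h, hpF x hx] at h1
    exact hxi (Complex.conj_eq_iff_im.1 h1.symm)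
  set U : Set ℂ := ball 0 D ∩ {x | 0 < x.im} with hU
  have hUc : IsPreconnected U :=
    ((convex_ball _ _).inter (convex_halfSpace_im_gt 0)).isPreconnected
  have hcont : ContinuousOn (fun x => (F x).im) U :=
    Complex.continuous_im.comp_continuousOn (hF.mono inter_subset_left)
  have hconst : (∀ x ∈ U, 0 < (F x).im) ∨ (∀ x ∈ U, (F x).im < 0) := by
    by_contra! hcon
    obtain ⟨⟨x, hx, hx1⟩, ⟨y, hy, hy1⟩⟩ := hcon
    obtain ⟨w, hw, hw0⟩ := hUc.intermediate_value hx hy hcont ⟨hx1, hy1⟩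
    exact hne w hw.1 hw.2.ne' hw0
  have him : ∀ x ∈ ball (0 : ℂ) D, (F (starRingEnd ℂ x)).im = -(F x).im := by
    intro x hx; rw [hsymm x hx]; simp
  rcases hconst with h | h
  · left
    intro x hx
    rcases lt_trichotomy x.im 0 with hi | hi | hi
    · have := h (starRingEnd ℂ x) ⟨hball x hx, by simpa using hi⟩
      rw [him x hx] at this
      nlinarith
    · simp [hi]
    · exact mul_nonneg (h x ⟨hx, hi⟩).le hi.le
  · right
    intro x hx
    rw [Complex.neg_im]
    rcases lt_trichotomy x.im 0 with hi | hi | hi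
    · have := h (starRingEnd ℂ x) ⟨hball x hx, by simpa using hi⟩
      rw [him x hx] at this
      nlinarith
    · simp [hi]
    · have := h x ⟨hx, hi⟩
      nlinarith

/-- An inverse branch at a real zero, normalized to be typically real. -/
lemma exists_normalized (hD : 0 < D)
    (hcrit : ∀ w, ‖p.eval w‖ < D → p.derivative.eval w ≠ 0)
    (hconj : ∀ w, p.eval (starRingEnd ℂ w) = starRingEnd ℂ (p.eval w))
    {z : ℂ} (hz : p.eval z = 0) (hzi : z.im = 0) {F : ℂ → ℂ} (hF : ContinuousOn F (ball 0 D))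
    (hF0 : F 0 = z) (hpF : ∀ x ∈ ball (0 : ℂ) D, p.eval (F x) = x) :
    ∃ f : ℂ → ℂ, (∀ x, ‖f x‖ = ‖F x - z‖) ∧ DifferentiableOn ℂ f (ball 0 D) ∧ f 0 = 0 ∧
      ‖deriv f 0‖ = ‖p.derivative.eval z‖⁻¹ ∧ deriv f 0 ≠ 0 ∧
      ∀ x ∈ ball (0 : ℂ) D, 0 ≤ (f x).im * x.im := by
  obtain ⟨G, hG, hG0, hpG, hu⟩ := exists_inverse_branch hD hcrit (by simpa using hD) hz
  have hFG := hu F hF hF0 hpF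
  have hsign := inverse_branch_sign hconj hF hpF
    (fun H hH hH0 hpH => (hu H hH (hH0.trans hF0) hpH).trans hFG.symm) (by rw [hF0, hzi])
  have hder : ∀ x ∈ ball (0 : ℂ) D, HasDerivAt F (p.derivative.eval (F x))⁻¹ x :=
    fun x hx => inverse_branch_hasDerivAt hcrit hF hpF hx
  have h00 := (hder 0 (mem_ball_self hD)).sub_const z
  rw [hF0] at h00
  have hnz : p.derivative.eval z ≠ 0 := hcrit z (by simpa [hz] using hD)
  have hdiff : DifferentiableOn ℂ (fun x => F x - z) (ball 0 D) :=
    fun x hx => ((hder x hx).sub_const z).differentiableAt.differentiableWithinAt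
  rcases hsign with h | h
  · refine ⟨fun x => F x - z, fun x => rfl, hdiff, by simp [hF0], ?_, ?_, ?_⟩
    · rw [h00.deriv, norm_inv]
    · rw [h00.deriv]; exact inv_ne_zero hnz
    · simpa [hzi] using h
  · refine ⟨fun x => -(F x - z), fun x => norm_neg _, hdiff.neg, by simp [hF0], ?_, ?_, ?_⟩
    · rw [h00.fun_neg.deriv, norm_neg, norm_inv]
    · rw [h00.fun_neg.deriv]; exact neg_ne_zero.2 (inv_ne_zero hnz)
    · simpa [hzi] using h

/-- Lower distortion bound for sublevel sets of a real polynomial without critical points over a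
disc. -/
lemma ball_subset_sublevel {r : ℝ} (hr : 0 < r) (hrD : r < D)
    (hcrit : ∀ w, ‖p.eval w‖ < D → p.derivative.eval w ≠ 0)
    (hconj : ∀ w, p.eval (starRingEnd ℂ w) = starRingEnd ℂ (p.eval w))
    {z : ℂ} (hz : p.eval z = 0) (hzi : z.im = 0) {w : ℂ}
    (hw : ‖w - z‖ < r / 40 * ‖p.derivative.eval z‖⁻¹) : ‖p.eval w‖ ≤ r := by
  have hD := hr.trans hrD
  obtain ⟨F, hF, hF0, hpF, -⟩ := exists_inverse_branch hD hcrit (by simpa using hD) hz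
  obtain ⟨f, hfF, hf, hf0, hfd, hfd0, hsign⟩ := exists_normalized hD hcrit hconj hz hzi hF hF0 hpF
  have hcl : closure (ball (0 : ℂ) (r / 5)) ⊆ ball 0 D := by
    rw [closure_ball _ (by positivity)]; exact closedBall_subset_ball (by linarith)
  have hdF : DifferentiableOn ℂ F (ball 0 D) := fun x hx =>
    (inverse_branch_hasDerivAt hcrit hF hpF hx).differentiableAt.differentiableWithinAt
  -- The quantitative open mapping theorem halves ε, which turns r/20 into r/40.
  have key := DiffContOnCl.ball_subset_image_closedBall (f := F) (z₀ := 0) (r := r / 5)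
    (ε := r / 20 * ‖p.derivative.eval z‖⁻¹) (hdF.mono hcl).diffContOnCl (by positivity)
    (fun x hx => by
      rw [hF0, ← hfF, ← hfd]
      exact typicallyReal_lower hr hrD hf hf0 hfd0 hsign (by simpa using hx)) (by
      have h1 := (inverse_branch_hasDerivAt hcrit hF hpF (mem_ball_self hD)).eventually_ne
        (c := F 0) (by rw [hF0]; exact inv_ne_zero (hcrit z (by simpa [hz] using hD)))
      exact h1.frequently.filter_mono nhdsWithin_le_nhds)
  obtain ⟨x, hx, rfl⟩ := key (show w ∈ ball (F 0) _ by
    rw [hF0, mem_ball, dist_eq_norm]; refine hw.trans_eq ?_; ring)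
  have hx' : ‖x‖ ≤ r / 5 := by simpa using hx
  rw [hpF x (by simp; linarith)]
  linarith

/-- Upper distortion bound for sublevel sets of a real polynomial with real zeros and without
critical points over a disc. -/
lemma sublevel_subset_ball {r s : ℝ} (hr : 0 < r) (hrD : r < D) (hs : s < r)
    (hcrit : ∀ w, ‖p.eval w‖ < D → p.derivative.eval w ≠ 0)
    (hconj : ∀ w, p.eval (starRingEnd ℂ w) = starRingEnd ℂ (p.eval w))
    (hreal : ∀ z, p.eval z = 0 → z.im = 0) {w : ℂ} (hw : ‖p.eval w‖ ≤ s) :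
    ∃ z, p.eval z = 0 ∧ ‖w - z‖ ≤
      s * (r ^ 2 * (1 + 2 * s / (r - s)) / (r ^ 2 - s ^ 2)) * ‖p.derivative.eval z‖⁻¹ := by
  have hD := hr.trans hrD
  obtain ⟨F, hF, hFw, hpF, -⟩ := exists_inverse_branch hD hcrit (ζ := p.eval w) (w := w)
    (by linarith) rfl
  have hz : p.eval (F 0) = 0 := hpF 0 (mem_ball_self hD)
  obtain ⟨f, hfF, hf, hf0, hfd, hfd0, hsign⟩ :=
    exists_normalized hD hcrit hconj hz (hreal _ hz) hF rfl hpF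
  refine ⟨F 0, hz, ?_⟩
  have := typicallyReal_upper hr hrD hf hf0 hfd0 hsign hs hw
  rwa [hfF, hFw, hfd] at this

end InverseBranch

end FibonacciHamiltonian

/-! ### Repetitions in the Fibonacci potential. -/

namespace FibonacciHamiltonian

open Real

section Potential

/-- Adding φ⁻¹ crosses an integer exactly when the fractional part is at least 1 - φ⁻¹. -/
lemma potential_eq_floor (lam : ℝ) (n : ℤ) : potential lam 0 n =
    lam * ((⌊((n : ℝ) + 1) * goldenRatio⁻¹⌋ - ⌊(n : ℝ) * goldenRatio⁻¹⌋ : ℤ) : ℝ) := by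
  have h0 : 0 < goldenRatio⁻¹ := inv_pos.2 goldenRatio_pos
  have h1 : goldenRatio⁻¹ < 1 := inv_lt_one_of_one_lt₀ one_lt_goldenRatio
  unfold potential
  congr 1
  rw [add_zero]
  set x := (n : ℝ) * goldenRatio⁻¹ with hx
  have e : ((n : ℝ) + 1) * goldenRatio⁻¹ = x + goldenRatio⁻¹ := by rw [hx]; ring
  rw [e]
  have f1 := Int.floor_add_fract x
  have f2 := Int.fract_lt_one x
  have f3 := Int.fract_nonneg x
  by_cases hc : 1 - goldenRatio⁻¹ ≤ Int.fract x
  · rw [Set.indicator_of_mem (Set.mem_Ico.2 ⟨hc, f2⟩)]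
    have : ⌊x + goldenRatio⁻¹⌋ = ⌊x⌋ + 1 := by
      rw [Int.floor_eq_iff]; push_cast; constructor <;> linarith
    rw [this]; simp
  · rw [Set.indicator_of_notMem (fun h => hc (Set.mem_Ico.1 h).1)]
    have : ⌊x + goldenRatio⁻¹⌋ = ⌊x⌋ := by
      rw [Int.floor_eq_iff]; constructor <;> linarith
    rw [this]; simp

lemma fib_mul_inv_goldenRatio (k : ℕ) :
    (Nat.fib (k + 1) : ℝ) * goldenRatio⁻¹ = Nat.fib k - goldenConj ^ (k + 1) := by
  have h := fib_succ_sub_goldenRatio_mul_fib k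
  have h1 : (Nat.fib (k + 1) : ℝ) = goldenRatio * Nat.fib k + goldenConj ^ k := by linarith
  rw [h1, add_mul, mul_right_comm, mul_inv_cancel₀ goldenRatio_ne_zero, inv_goldenRatio]
  ring

lemma abs_goldenConj_pow_mul (k : ℕ) : |goldenConj ^ k| * goldenRatio ^ k = 1 := by
  rw [abs_pow, ← mul_pow, ← abs_of_pos goldenRatio_pos, ← abs_mul, goldenConj_mul_goldenRatio]
  simp

/-- Denominators below `fib (k + 1)` approximate the golden mean worse than `fib (k + 1)` does. -/
lemma abs_goldenConj_pow_lt (k : ℕ) (j : ℕ) (hj : 1 ≤ j) (hjk : j < Nat.fib (k + 1)) (p : ℤ) :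
    |goldenConj ^ (k + 1)| < |(j : ℝ) * goldenRatio⁻¹ - p| := by
  by_contra! hcon
  set η := |goldenConj ^ (k + 1)| with hη
  have hη0 : 0 ≤ η := abs_nonneg _
  have hηφ : η * goldenRatio ^ (k + 1) = 1 := abs_goldenConj_pow_mul (k + 1)
  have hη1 : η ≤ 1 := by
    have : 1 ≤ goldenRatio ^ (k + 1) := one_le_pow₀ one_lt_goldenRatio.le
    nlinarith
  have hηpos : 0 < η := by
    rcases hη0.eq_or_lt with h | h
    · rw [← h] at hηφ; simp at hηφ
    · exact h
  have hs5 : (2 : ℝ) < √5 := by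
    rw [lt_sqrt (by norm_num)]; norm_num
  have hdiff : goldenRatio - goldenConj = √5 := goldenRatio_sub_goldenConj
  have hbinet : √5 * (Nat.fib (k + 1) : ℝ) = goldenRatio ^ (k + 1) - goldenConj ^ (k + 1) := by
    rw [coe_fib_eq]; field_simp
  -- The product with the algebraic conjugate is an integer norm form, nonzero by irrationality, so
  -- of modulus at least 1.
  have hnorm : ((j : ℝ) * goldenRatio⁻¹ - p) * (-(j * goldenRatio) - p) =
      ((p ^ 2 + j * p - j ^ 2 : ℤ) : ℝ) := by
    rw [inv_goldenRatio]
    push_cast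
    linear_combination (j ^ 2 : ℝ) * goldenRatio_mul_goldenConj +
      (j * p : ℝ) * goldenRatio_add_goldenConj
  have hne : (p ^ 2 + j * p - j ^ 2 : ℤ) ≠ 0 := by
    intro h0
    rw [h0, Int.cast_zero, mul_eq_zero] at hnorm
    have hj0 : (j : ℤ) ≠ 0 := by omega
    rcases hnorm with h | h
    · have := (goldenConj_irrational.natCast_mul (by omega : j ≠ 0)).add_intCast p
      exact this ⟨0, by rw [inv_goldenRatio] at h; push_cast; linarith⟩
    · have := (goldenRatio_irrational.natCast_mul (by omega : j ≠ 0)).add_intCast p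
      exact this ⟨0, by push_cast; linarith⟩
  have h1 : (1 : ℝ) ≤ |((p ^ 2 + j * p - j ^ 2 : ℤ) : ℝ)| := by
    exact_mod_cast Int.one_le_abs hne
  rw [← hnorm, abs_mul] at h1
  have h2 : |(-((j : ℝ) * goldenRatio) - p)| ≤ j * √5 + η := by
    have e : -((j : ℝ) * goldenRatio) - p = (j * goldenRatio⁻¹ - p) - j * √5 := by
      rw [inv_goldenRatio, ← hdiff]; ring
    rw [e]
    refine (abs_sub _ _).trans ?_
    rw [abs_of_nonneg (by positivity : 0 ≤ (j : ℝ) * √5)]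
    linarith
  have h3 : (1 : ℝ) ≤ η * (j * √5 + η) :=
    h1.trans (mul_le_mul hcon h2 (abs_nonneg _) hη0)
  have h4 : (j : ℝ) + 1 ≤ Nat.fib (k + 1) := by exact_mod_cast hjk
  have h5 : -η ≤ goldenConj ^ (k + 1) := neg_abs_le _
  -- Binet's formula gives j√5 + η ≤ φ^(k+1) + 2η - √5, and 2η ≤ 2 < √5.
  have h6 : (j : ℝ) * √5 + η < goldenRatio ^ (k + 1) := by
    have : √5 * ((j : ℝ) + 1) ≤ √5 * Nat.fib (k + 1) := by gcongr
    linarith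
  nlinarith

/-- The shift by F_{k+1} changes j/φ by an integer minus ψ^(k+1), too little to cross an integer by
best approximation. At j = F_{k+1} that bound fails, but -η and -2η have the same floor because |η|
< 1/2. -/
lemma floor_fib_add (k : ℕ) (hk : 1 ≤ k) (j : ℕ) (hj : 1 ≤ j) (hjk : j ≤ Nat.fib (k + 1)) :
    ⌊((Nat.fib (k + 1) : ℝ) + j) * goldenRatio⁻¹⌋ = Nat.fib k + ⌊(j : ℝ) * goldenRatio⁻¹⌋ := by
  have hη : |goldenConj ^ (k + 1)| < 1 / 2 := by
    have h1 := abs_goldenConj_pow_mul (k + 1)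
    have h2 : goldenRatio ^ 2 ≤ goldenRatio ^ (k + 1) :=
      pow_le_pow_right₀ one_lt_goldenRatio.le (by omega)
    rw [goldenRatio_sq] at h2
    have := one_lt_goldenRatio
    have h3 := abs_nonneg (goldenConj ^ (k + 1))
    nlinarith
  have e := fib_mul_inv_goldenRatio k
  have e1 : ((Nat.fib (k + 1) : ℝ) + j) * goldenRatio⁻¹ =
      ((Nat.fib k : ℤ) : ℝ) + (j * goldenRatio⁻¹ - goldenConj ^ (k + 1)) := by
    rw [add_mul, e]; push_cast; ring
  rw [e1, Int.floor_intCast_add]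
  congr 1
  have happrox := abs_goldenConj_pow_lt k j hj
  have hne : goldenConj ^ (k + 1) ≠ 0 := pow_ne_zero _ goldenConj_ne_zero
  generalize goldenConj ^ (k + 1) = η at *
  have hη' := abs_lt.1 hη
  rcases hjk.lt_or_eq with hlt | rfl
  · have m1 := happrox hlt ⌊(j : ℝ) * goldenRatio⁻¹⌋
    have m2 := happrox hlt (⌊(j : ℝ) * goldenRatio⁻¹⌋ + 1)
    have f1 := Int.floor_le ((j : ℝ) * goldenRatio⁻¹)
    have f2 := Int.lt_floor_add_one ((j : ℝ) * goldenRatio⁻¹)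
    push_cast at m2
    rw [abs_of_nonneg (sub_nonneg.2 f1)] at m1
    rw [abs_of_neg (sub_neg.2 f2)] at m2
    obtain ⟨b1, b2⟩ := abs_le.1 (le_refl |η|)
    rw [Int.floor_eq_iff]
    constructor <;> linarith
  · rw [e]
    have e2 : (Nat.fib k : ℝ) - η - η = ((Nat.fib k : ℤ) : ℝ) + (-2 * η) := by push_cast; ring
    have e3 : (Nat.fib k : ℝ) - η = ((Nat.fib k : ℤ) : ℝ) + (- η) := by push_cast; ring
    rw [e2, e3, Int.floor_intCast_add, Int.floor_intCast_add]
    congr 1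
    rcases hne.lt_or_gt with h | h
    · rw [Int.floor_eq_zero_iff.2 ⟨by linarith, by linarith⟩,
        Int.floor_eq_zero_iff.2 ⟨by linarith, by linarith⟩]
    · have t : ∀ x : ℝ, -1 ≤ x → x < 0 → ⌊x⌋ = -1 := by
        intro x h1 h2; rw [Int.floor_eq_iff]; push_cast; constructor <;> linarith
      rw [t _ (by linarith) (by linarith), t _ (by linarith) (by linarith)]

lemma potential_fib_add (lam : ℝ) (k : ℕ) (hk : 2 ≤ k) (j : ℕ) (hj : 1 ≤ j) (hjk : j ≤ Nat.fib k) :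
    potential lam 0 ((Nat.fib (k + 1) : ℤ) + j) = potential lam 0 j := by
  -- The floor identity is also applied at `j + 1`; this inequality fails for k = 1.
  have h1 : Nat.fib k + 1 ≤ Nat.fib (k + 1) := by
    obtain ⟨m, rfl⟩ : ∃ m, k = m + 2 := ⟨k - 2, by omega⟩
    have h2 := Nat.fib_pos.2 (by omega : 0 < m + 1)
    rw [show m + 2 + 1 = m + 1 + 2 by ring, Nat.fib_add_two (n := m + 1),
      show m + 2 = m + 1 + 1 by ring]
    omega
  rw [potential_eq_floor, potential_eq_floor]
  have a1 := floor_fib_add k (by omega) j hj (by omega)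
  have a2 := floor_fib_add k (by omega) (j + 1) (by omega) (by omega)
  push_cast at a1 a2 ⊢
  rw [add_assoc, a1, a2]
  push_cast
  ring

lemma inv_goldenRatio_bounds : 0.6 < goldenRatio⁻¹ ∧ goldenRatio⁻¹ < 0.65 := by
  have h := goldenRatio_sq
  have h1 := one_lt_goldenRatio
  have h2 : goldenRatio⁻¹ = goldenRatio - 1 := by
    linarith [inv_goldenRatio, goldenRatio_add_goldenConj]
  rw [h2]
  constructor <;> nlinarith

lemma potential_one (lam : ℝ) : potential lam 0 1 = lam := by
  obtain ⟨h1, h2⟩ := inv_goldenRatio_bounds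
  rw [potential_eq_floor]
  have e1 : ⌊(((1 : ℤ) : ℝ) + 1) * goldenRatio⁻¹⌋ = 1 := by
    rw [Int.floor_eq_iff]; push_cast; constructor <;> linarith
  have e2 : ⌊((1 : ℤ) : ℝ) * goldenRatio⁻¹⌋ = 0 := by
    rw [Int.floor_eq_iff]; push_cast; constructor <;> linarith
  rw [e1, e2]; simp

lemma potential_two (lam : ℝ) : potential lam 0 2 = 0 := by
  obtain ⟨h1, h2⟩ := inv_goldenRatio_bounds
  rw [potential_eq_floor]
  have e1 : ⌊(((2 : ℤ) : ℝ) + 1) * goldenRatio⁻¹⌋ = 1 := by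
    rw [Int.floor_eq_iff]; push_cast; constructor <;> linarith
  have e2 : ⌊((2 : ℤ) : ℝ) * goldenRatio⁻¹⌋ = 1 := by
    rw [Int.floor_eq_iff]; push_cast; constructor <;> linarith
  rw [e1, e2]; simp

end Potential

/-! ### The trace map recursion. -/

section Transfer

variable (lam : ℝ) (z : ℂ)

lemma det_transferMatrix (n : ℕ) : (transferMatrix lam 0 n z).det = 1 := by
  induction n with
  | zero => simp [transferMatrix]
  | succ n ih =>
    rw [transferMatrix, Matrix.det_mul, ih]
    simp [stepMatrix, Matrix.det_fin_two]

lemma transferMatrix_fib_add (k : ℕ) (hk : 2 ≤ k) (j : ℕ) (hj : j ≤ Nat.fib k) :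
    transferMatrix lam 0 (Nat.fib (k + 1) + j) z =
      transferMatrix lam 0 j z * transferMatrix lam 0 (Nat.fib (k + 1)) z := by
  induction j with
  | zero => simp [transferMatrix]
  | succ j ih =>
    have hp := potential_fib_add lam k hk (j + 1) (by omega) hj
    rw [← add_assoc, transferMatrix, ih (by omega), transferMatrix, ← mul_assoc]
    congr 2
    unfold stepMatrix
    push_cast at hp ⊢
    rw [← hp, add_assoc]

lemma fibMatrix_add_three (k : ℕ) :
    fibMatrix lam (k + 3) z = fibMatrix lam (k + 1) z * fibMatrix lam (k + 2) z := by
  unfold fibMatrix fibNum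
  rw [← transferMatrix_fib_add lam z (k + 2) (by omega) _ le_rfl]
  congr 1
  rw [Nat.fib_add_two (n := k + 2)]
  ring_nf

/-- Cayley–Hamilton A² = tr(A) A - 1, under the trace with `B`. -/
lemma trace_mul_mul_self (A B : Matrix (Fin 2) (Fin 2) ℂ) (hA : A.det = 1) :
    (A * (B * A)).trace = A.trace * (B * A).trace - B.trace := by
  rw [Matrix.det_fin_two] at hA
  simp [Matrix.trace_fin_two, Matrix.mul_apply, Fin.sum_univ_two]
  linear_combination (-(B 0 0) - B 1 1) * hA

lemma fibMatrix_one : fibMatrix lam 1 z = !![z - lam, -1; 1, 0] := by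
  simp [fibMatrix, fibNum, transferMatrix, stepMatrix, potential_one]

lemma fibMatrix_two : fibMatrix lam 2 z = !![z, -1; 1, 0] * fibMatrix lam 1 z := by
  have : (1 : ℤ) + 1 = 2 := rfl
  rw [fibMatrix_one]
  simp [fibMatrix, fibNum, transferMatrix, stepMatrix, potential_one, Nat.fib_add_two, this,
    potential_two]

lemma halfTrace_eq_traceVal (k : ℕ) : halfTrace lam k z = traceVal lam z (k + 1) := by
  induction k using Nat.strong_induction_on with
  | _ k ih =>
    match k with
    | 0 => simp [halfTrace]
    | 1 => simp [halfTrace, fibMatrix_one, Matrix.trace_fin_two]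
    | 2 =>
      rw [traceVal_add_three]
      simp [halfTrace, fibMatrix_two, fibMatrix_one, Matrix.trace_fin_two]
      ring
    -- The role of M_0 is played by the free matrix of half trace z/2, not by `fibMatrix lam 0`, so
    -- this case is separate.
    | 3 =>
      rw [traceVal_add_three, ← ih 2 (by omega), ← ih 1 (by omega), ← ih 0 (by omega)]
      simp only [halfTrace]
      have h := trace_mul_mul_self (fibMatrix lam 1 z) !![z, -1; 1, 0]
        (det_transferMatrix lam z _)
      rw [← fibMatrix_two, ← fibMatrix_add_three lam z 0] at h
      rw [h]
      simp [Matrix.trace_fin_two]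
      ring
    | n + 4 =>
      rw [traceVal_add_three, ← ih (n + 3) (by omega), ← ih (n + 2) (by omega),
        ← ih (n + 1) (by omega)]
      simp only [halfTrace]
      have h := trace_mul_mul_self (fibMatrix lam (n + 2) z) (fibMatrix lam (n + 1) z)
        (det_transferMatrix lam z _)
      rw [← fibMatrix_add_three lam z n, ← fibMatrix_add_three lam z (n + 1)] at h
      rw [h]
      ring

end Transfer

/-! ### Zeros of the half traces are real. -/

section RealZeros

/-- The symplectic form `Im (v₀ \bar v₁)`. -/
def imForm (v : Fin 2 → ℂ) : ℝ := (v 0 * starRingEnd ℂ (v 1)).im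

lemma imForm_stepMatrix (lam : ℝ) (n : ℤ) (z : ℂ) (v : Fin 2 → ℂ) :
    imForm ((stepMatrix lam 0 n z).mulVec v) = imForm v + z.im * Complex.normSq (v 0) := by
  simp [imForm, stepMatrix, Matrix.mulVec, dotProduct, Fin.sum_univ_two, Complex.normSq_apply]
  ring

lemma imForm_transferMatrix (lam : ℝ) {z : ℂ} (hz : 0 ≤ z.im) (v : Fin 2 → ℂ) (n : ℕ) :
    imForm v ≤ imForm ((transferMatrix lam 0 n z).mulVec v) := by
  induction n with
  | zero => simp [transferMatrix]
  | succ n ih =>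
    rw [transferMatrix, ← Matrix.mulVec_mulVec, imForm_stepMatrix]
    have := mul_nonneg hz (Complex.normSq_nonneg ((transferMatrix lam 0 n z).mulVec v 0))
    linarith

lemma imForm_transferMatrix_succ (lam : ℝ) {z : ℂ} (hz : 0 ≤ z.im) (v : Fin 2 → ℂ) (n : ℕ) :
    imForm v + z.im * Complex.normSq (v 0) ≤
      imForm ((transferMatrix lam 0 (n + 1) z).mulVec v) := by
  induction n with
  | zero =>
    rw [transferMatrix, ← Matrix.mulVec_mulVec, imForm_stepMatrix]
    simp [transferMatrix]
  | succ n ih =>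
    rw [transferMatrix, ← Matrix.mulVec_mulVec, imForm_stepMatrix]
    have := mul_nonneg hz (Complex.normSq_nonneg ((transferMatrix lam 0 (n + 1) z).mulVec v 0))
    linarith

/-- Trace 0 and determinant 1 give M² = -1, which preserves `imForm`, whereas for Im z > 0 the first
application to (1, 0) increases it strictly and the second cannot decrease it. -/
lemma trace_transferMatrix_ne_zero (lam : ℝ) {z : ℂ} (hz : 0 < z.im) (n : ℕ) :
    (transferMatrix lam 0 (n + 1) z).trace ≠ 0 := by
  intro h0
  have hd := det_transferMatrix lam z (n + 1)
  have h1 := imForm_transferMatrix_succ lam hz.le ![1, 0] n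
  have h2 := imForm_transferMatrix lam hz.le
    ((transferMatrix lam 0 (n + 1) z).mulVec ![1, 0]) (n + 1)
  have h3 : (transferMatrix lam 0 (n + 1) z).mulVec
      ((transferMatrix lam 0 (n + 1) z).mulVec ![1, 0]) = -![1, 0] := by
    rw [Matrix.trace_fin_two] at h0
    rw [Matrix.det_fin_two] at hd
    ext i
    fin_cases i
    · simp [Matrix.mulVec, dotProduct, Fin.sum_univ_two]
      linear_combination -hd + transferMatrix lam 0 (n + 1) z 0 0 * h0
    · simp [Matrix.mulVec, dotProduct, Fin.sum_univ_two]
      linear_combination transferMatrix lam 0 (n + 1) z 1 0 * h0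
  rw [h3] at h2
  simp [imForm] at h1 h2
  linarith

lemma im_eq_zero_of_traceVal_eq_zero {lam : ℝ} {z : ℂ} {k : ℕ} (hk : 1 ≤ k)
    (h : traceVal lam z (k + 1) = 0) : z.im = 0 := by
  have key : ∀ w : ℂ, 0 < w.im → traceVal lam w (k + 1) ≠ 0 := by
    intro w hw h0
    obtain ⟨k, rfl⟩ : ∃ m, k = m + 1 := ⟨k - 1, by omega⟩
    rw [← halfTrace_eq_traceVal] at h0
    obtain ⟨n, hn⟩ : ∃ n, fibNum (k + 1) = n + 1 :=
      Nat.exists_eq_succ_of_ne_zero (Nat.fib_pos.2 (by omega)).ne'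
    refine trace_transferMatrix_ne_zero lam hw n ?_
    rw [← hn]
    simpa [halfTrace, fibMatrix] using h0
  rcases lt_trichotomy z.im 0 with hi | hi | hi
  · refine absurd ?_ (key (starRingEnd ℂ z) (by simpa using hi))
    have := tracePoly_eval_conj lam z (k + 1)
    rw [traceVal, this]
    simpa [traceVal] using h
  · exact hi
  · exact absurd h (key z hi)

end RealZeros

end FibonacciHamiltonian

/-! ### Constants and conclusion. -/

namespace FibonacciHamiltonian

lemma returnCount_eq_smallCount (lam : ℝ) (k : ℕ) (z : ℂ) :
    returnCount lam k z = smallCount lam z (k + 1) := by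
  simp [returnCount, smallCount, halfTrace_eq_traceVal]

lemma mem_zeroSet_iff {lam : ℝ} {k : ℕ} {z : ℂ} :
    z ∈ zeroSet lam k ↔ (tracePoly lam (k + 1)).eval z = 0 := by
  simp [zeroSet, halfTrace_eq_traceVal, traceVal]

lemma mem_sigmaSet_iff {lam δ : ℝ} {k : ℕ} {z : ℂ} :
    z ∈ sigmaSet lam k δ ↔ ‖(tracePoly lam (k + 1)).eval z‖ ≤ 1 + δ := by
  simp [sigmaSet, halfTrace_eq_traceVal, traceVal]

lemma tracePoly_no_critical_point {lam D : ℝ} (hD1 : 1 ≤ D)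
    (hK : 2 + 3 * D ^ 2 + 2 * D ^ 3 ≤ 1 + lam ^ 2 / 4) (k : ℕ) (w : ℂ)
    (hw : ‖(tracePoly lam (k + 1)).eval w‖ < D) :
    (tracePoly lam (k + 1)).derivative.eval w ≠ 0 := by
  have := (chain (z := w) hD1 hK (k + 1) (by omega) hw.le).1
  intro h
  rw [traceDer, h, norm_zero] at this
  norm_num at this

lemma couplingThreshold_bounds {δ lam : ℝ} (hδ : 0 < δ) (hl : couplingThreshold (2 * δ) < lam) :
    2 + 3 * (1 + 2 * δ) ^ 2 + 2 * (1 + 2 * δ) ^ 3 ≤ 1 + lam ^ 2 / 4 ∧ 4 < lam ∧ 24 < lam ^ 2 := by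
  unfold couplingThreshold at hl
  have h0 : 0 < lam := (Real.sqrt_nonneg _).trans_lt hl
  have h1 := (Real.sqrt_lt' h0).1 hl
  have h2 : 1 ≤ (1 + 2 * δ) ^ 2 := one_le_pow₀ (by linarith)
  have h3 : 1 ≤ (1 + 2 * δ) ^ 3 := one_le_pow₀ (by linarith)
  exact ⟨by linarith, by nlinarith, by linarith⟩

lemma Sl_bounds {lam : ℝ} (hl : 8 < lam) : 0 < Sl lam ∧ Sl lam ≤ lam - 4 := by
  unfold Sl
  have h1 := Real.sqrt_nonneg ((lam - 4) ^ 2 - 12)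
  have h2 : Real.sqrt ((lam - 4) ^ 2 - 12) ≤ lam - 4 :=
    Real.sqrt_le_iff.2 ⟨by linarith, by linarith⟩
  constructor <;> linarith

end FibonacciHamiltonian

open FibonacciHamiltonian in
theorem mainTheorem7 (δ : ℝ) (hδ : 0 < δ) :
    ∃ c : ℝ, 0 < c ∧ ∃ d : ℝ, 0 < d ∧
      ∀ k : ℕ, 3 ≤ k → ∀ lam : ℝ,
        (FibonacciHamiltonian.couplingThreshold (2 * δ) < lam →
          (⋃ z ∈ FibonacciHamiltonian.zeroSet lam k,
            Metric.ball z (c * FibonacciHamiltonian.Su lam ^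
              (-(FibonacciHamiltonian.returnCount lam k z : ℤ)))) ⊆
            FibonacciHamiltonian.sigmaSet lam k δ) ∧
        (max (FibonacciHamiltonian.couplingThreshold (2 * δ)) 8 < lam →
          FibonacciHamiltonian.sigmaSet lam k δ ⊆
            ⋃ z ∈ FibonacciHamiltonian.zeroSet lam k,
              Metric.ball z (d * FibonacciHamiltonian.Sl lam ^
                (-(FibonacciHamiltonian.returnCount lam k z : ℤ)))) := by
  set s : ℝ := 1 + δ with hs
  -- An auxiliary radius strictly between the level 1 + δ and the critical-point-free radius 1 + 2δ.
  set r : ℝ := 1 + 3 / 2 * δ with hr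
  set C : ℝ := s * (r ^ 2 * (1 + 2 * s / (r - s)) / (r ^ 2 - s ^ 2)) with hC
  have hs0 : 0 < s := by linarith
  have hsr : s < r := by linarith
  have hC0 : 0 ≤ C := by
    have h1 : 0 < r - s := by linarith
    have h2 : 0 < r ^ 2 - s ^ 2 := by nlinarith
    positivity
  -- The factor 1/2 in the derivative bounds doubles 1/40 and C; the extra 1 makes the second ball
  -- estimate strict.
  refine ⟨1 / 20, by norm_num, 2 * C + 1, by linarith, fun k hk lam => ⟨fun hl => ?_, fun hl => ?_⟩⟩
  · obtain ⟨hK, hl4, hl24⟩ := couplingThreshold_bounds hδ hl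
    intro w hw
    simp only [Set.mem_iUnion, Metric.mem_ball, dist_eq_norm, exists_prop] at hw
    obtain ⟨z, hz, hwz⟩ := hw
    have hz0 := mem_zeroSet_iff.1 hz
    have hzi := im_eq_zero_of_traceVal_eq_zero (by omega) hz0
    have hup := traceDer_upper hl4 hl24 hzi (k + 1) (by omega) (by simp [traceVal, hz0])
    have hcrit := tracePoly_no_critical_point (by linarith : 1 ≤ 1 + 2 * δ) hK k
    have hpos : 0 < ‖traceDer lam z (k + 1)‖ :=
      norm_pos_iff.2 (hcrit z (by rw [hz0, norm_zero]; linarith))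
    have hSu : 0 < Su lam := by unfold Su; linarith
    rw [returnCount_eq_smallCount, zpow_neg, zpow_natCast] at hwz
    rw [mem_sigmaSet_iff]
    have := ball_subset_sublevel (r := 1) one_pos (by linarith) hcrit
      (fun w => tracePoly_eval_conj lam w (k + 1)) hz0 hzi (w := w) (hwz.trans_le ?_)
    · linarith
    · calc 1 / 20 * (Su lam ^ smallCount lam z (k + 1))⁻¹
          = 1 / 40 * (1 / 2 * Su lam ^ smallCount lam z (k + 1))⁻¹ := by
            rw [mul_inv]; ring
        _ ≤ 1 / 40 * ‖traceDer lam z (k + 1)‖⁻¹ := by gcongr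
  · obtain ⟨hl1, hl8⟩ := max_lt_iff.1 hl
    obtain ⟨hK, hl4, hl24⟩ := couplingThreshold_bounds hδ hl1
    obtain ⟨hS0, hS1⟩ := Sl_bounds hl8
    intro w hw
    rw [mem_sigmaSet_iff] at hw
    obtain ⟨z, hz0, hwz⟩ := sublevel_subset_ball (by linarith) (by linarith : r < 1 + 2 * δ) hsr
      (tracePoly_no_critical_point (by linarith : 1 ≤ 1 + 2 * δ) hK k)
      (fun w => tracePoly_eval_conj lam w (k + 1))
      (fun z hz => im_eq_zero_of_traceVal_eq_zero (by omega) hz) hw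
    simp only [Set.mem_iUnion, Metric.mem_ball, dist_eq_norm, exists_prop]
    refine ⟨z, mem_zeroSet_iff.2 hz0, hwz.trans_lt ?_⟩
    have hlow := traceDer_lower (z := z) hl8 (k + 1) (by omega) (by simp [traceVal, hz0])
    rw [returnCount_eq_smallCount, zpow_neg, zpow_natCast]
    have hpow : 0 < Sl lam ^ smallCount lam z (k + 1) := pow_pos hS0 _
    calc C * ‖traceDer lam z (k + 1)‖⁻¹
        ≤ C * (1 / 2 * Sl lam ^ smallCount lam z (k + 1))⁻¹ := by
          gcongr
          exact le_trans (by gcongr) hlow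
      _ = 2 * C * (Sl lam ^ smallCount lam z (k + 1))⁻¹ := by rw [mul_inv]; ring
      _ < (2 * C + 1) * (Sl lam ^ smallCount lam z (k + 1))⁻¹ := by
          have := inv_pos.2 hpow
          nlinarith
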